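/- Let $V$ be a complex Hilbert space (inner product $\langle\cdot|\cdot\rangle$ antilinear in the first slot), and let $SV=\bigoplus_{d\ge 0} S^dV$ be its symmetric algebra, with the inner product for which distinct degrees are perpendicular and $\langle x_1\cdots x_d\,|\,y_1\cdots y_d\rangle=\sum_{\pi}\prod_{k}\langle x_k|y_{\pi(k)}\rangle$, the sum running over all permutations $\pi$ of $\{1,\dots,d\}$. Let $SV'$ be the space of all antilinear functionals $SV\to\mathbb C$, a commutative algebra under $[\Phi\Psi](\theta)=[\Phi\otimes\Psi](\Delta\theta)$, where $\Delta$ is the algebra homomorphism $SV\to SV\otimes SV$ with $\Delta v=v\otimes 1+1\otimes v$ for $v\in V$. For $\Phi\in SV'$, a finite-dimensional subspace $M\subset V$ and $d\ge 0$, let $\Phi_M^d$ be the unique element of $S^dM$ with $\Phi(\psi)=\langle\psi|\Phi_M^d\rangle$ for all $\psi\in S^dM$. Put $\|\Phi\|=\sup_M\bigl(\sum_{d}\|\Phi_M^d\|^2\bigr)^{1/2}\in[0,\infty]$ and let $S[V]=\{\Phi\in SV':\|\Phi\|<\infty\}$ be symmetric Fock space. Let $V'$ be the space of all antilinear functionals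 on $V$, and let $Z:V\to V'$ be antilinear and symmetric, that is, $Zx(y)=Zy(x)$ for all $x,y\in V$. Let $\zeta\in SV'$ be the functional that vanishes on $S^dV$ for $d\ne 2$ and satisfies $\zeta(xy)=Zx(y)$ for $x,y\in V$, and let $e^Z=\sum_{n\ge 0}\zeta^n/n!\in SV'$ (a finite sum on each element of $SV$). Then: 1. $e^Z\in S[V]$ if and only if $Z$ is given by a Hilbert–Schmidt antilinear operator on $V$ of operator norm strictly less than $1$; that is, if and only if there is a bounded antilinear operator $T:V\to V$ with $Zx(y)=\langle y|Tx\rangle$ for all $x,y\in V$ such that $T$ is Hilbert–Schmidt and $\|T\|<1$. 2. In that case, identifying $Z$ with $T$, the Fredholm determinant ${\rm Det}(I-Z^2)$ exists and is a strictly positive real number, and $$\|e^Z\|^2={\rm Det}^{1/2}(I-Z^2)^{-1}=\frac{1}{\sqrt{{\rm Det}(I-Z^2)}}.$$ Here ${\rm Det}(I+A)=\sum_{k\ge 0}{\rm Tr}\,\Lambda^k A$, computed in any orthonormal basis $(b_i)$ as the unconditionally convergent sum of the principal minors $\det[\langle b_i|Ab_j\rangle]_{i,j\in S}$ over all finite sets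 $S$ of indices. -/

import Mathlib

open scoped TensorProduct ENNReal ComplexConjugate

noncomputable section

namespace Fock

section Defs

variable (V : Type*) [NormedAddCommGroup V] [InnerProductSpace ℂ V]

/-- The symmetric algebra `SV`, a bialgebra with coproduct induced by the diagonal of `V`. -/
abbrev Sym : Type _ := SymmetricAlgebra ℂ V

/-- The full antidual `SV'`: all antilinear functionals on `SV`. -/
abbrev Antidual : Type _ := Sym V →ₗ⋆[ℂ] ℂ

variable {V}

/-- The antilinear functional `Φ ⊗ Ψ` on `SV ⊗ SV`. -/
def Antidual.tensor (Φ Ψ : Antidual V) : Sym V ⊗[ℂ] Sym V →ₗ⋆[ℂ] ℂ :=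
  TensorProduct.lift
    (LinearMap.mk₂'ₛₗ (starRingEnd ℂ) (starRingEnd ℂ) (fun x y : Sym V => Φ x * Ψ y)
      (by intros; simp [add_mul]) (by intros; simp [mul_assoc])
      (by intros; simp [mul_add]) (by intros; simp [mul_left_comm]))

@[simp] theorem Antidual.tensor_tmul (Φ Ψ : Antidual V) (x y : Sym V) :
    Antidual.tensor Φ Ψ (x ⊗ₜ[ℂ] y) = Φ x * Ψ y := rfl

/-- The convolution product `[ΦΨ](θ) = [Φ ⊗ Ψ](Δθ)` on the antidual. -/
instance Antidual.instMul : Mul (Antidual V) where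
  mul Φ Ψ := (Antidual.tensor Φ Ψ).comp (Coalgebra.comul (R := ℂ) (A := Sym V))

theorem Antidual.mul_apply (Φ Ψ : Antidual V) (θ : Sym V) :
    (Φ * Ψ) θ = Antidual.tensor Φ Ψ (Coalgebra.comul (R := ℂ) θ) := rfl

/-- The unit `⟨· | 1⟩` of the antidual: the conjugated counit. -/
instance Antidual.instOne : One (Antidual V) where
  one := (starLinearEquiv ℂ (A := ℂ)).toLinearMap.comp (Coalgebra.counit (R := ℂ) (A := Sym V))

theorem Antidual.one_apply (θ : Sym V) :
    (1 : Antidual V) θ = conj (Coalgebra.counit (R := ℂ) θ) := rfl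

/-- Complex conjugation of antilinear functionals, into the convolution ring of linear ones. -/
def Antidual.toDual (Φ : Antidual V) : WithConv (Sym V →ₗ[ℂ] ℂ) :=
  WithConv.toConv ((starLinearEquiv ℂ (A := ℂ)).toLinearMap.comp Φ)

theorem Antidual.toDual_apply (Φ : Antidual V) (θ : Sym V) :
    Antidual.toDual Φ θ = conj (Φ θ) := rfl

theorem Antidual.toDual_injective : Function.Injective (Antidual.toDual (V := V)) := by
  intro Φ Ψ h
  ext θ
  have h1 : Antidual.toDual Φ θ = Antidual.toDual Ψ θ := by rw [h]
  exact (starRingEnd ℂ).injective h1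

theorem Antidual.mul_repr (Φ Ψ : Antidual V) {θ : Sym V} {κ : Type*}
    (r : Coalgebra.Repr ℂ θ κ) :
    (Φ * Ψ) θ = ∑ i ∈ r.index, Φ (r.left i) * Ψ (r.right i) := by
  rw [Antidual.mul_apply, ← r.eq, map_sum]
  rfl

theorem Antidual.toDual_mul (Φ Ψ : Antidual V) :
    Antidual.toDual (Φ * Ψ) = Antidual.toDual Φ * Antidual.toDual Ψ := by
  ext θ
  change Antidual.toDual (Φ * Ψ) θ = (Antidual.toDual Φ * Antidual.toDual Ψ) θ
  rw [Antidual.toDual_apply, (Coalgebra.Repr.arbitrary ℂ θ).convMul_apply,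
    Antidual.mul_repr Φ Ψ (Coalgebra.Repr.arbitrary ℂ θ)]
  simp [Antidual.toDual_apply]

theorem Antidual.toDual_one : Antidual.toDual (1 : Antidual V) = 1 := by
  ext θ
  change Antidual.toDual (1 : Antidual V) θ = (1 : WithConv (Sym V →ₗ[ℂ] ℂ)) θ
  simp [Antidual.toDual_apply, Antidual.one_apply]

theorem Antidual.toDual_add (Φ Ψ : Antidual V) :
    Antidual.toDual (Φ + Ψ) = Antidual.toDual Φ + Antidual.toDual Ψ := by
  ext θ
  change conj ((Φ + Ψ) θ) = conj (Φ θ) + conj (Ψ θ)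
  simp

/-- The antidual is a commutative ring under the convolution product. -/
instance Antidual.instCommRing : CommRing (Antidual V) where
  __ := (inferInstance : AddCommGroup (Sym V →ₗ⋆[ℂ] ℂ))
  mul_assoc Φ Ψ Θ := Antidual.toDual_injective (by simp only [Antidual.toDual_mul, mul_assoc])
  mul_comm Φ Ψ := Antidual.toDual_injective (by simp only [Antidual.toDual_mul, mul_comm])
  one_mul Φ := Antidual.toDual_injective (by
    simp only [Antidual.toDual_mul, Antidual.toDual_one, one_mul])
  mul_one Φ := Antidual.toDual_injective (by
    simp only [Antidual.toDual_mul, Antidual.toDual_one, mul_one])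
  left_distrib Φ Ψ Θ := Antidual.toDual_injective (by
    simp only [Antidual.toDual_mul, Antidual.toDual_add, mul_add])
  right_distrib Φ Ψ Θ := Antidual.toDual_injective (by
    simp only [Antidual.toDual_mul, Antidual.toDual_add, add_mul])
  zero_mul Φ := LinearMap.ext fun θ => by
    rw [Antidual.mul_repr _ _ (Coalgebra.Repr.arbitrary ℂ θ)]; simp
  mul_zero Φ := LinearMap.ext fun θ => by
    rw [Antidual.mul_repr _ _ (Coalgebra.Repr.arbitrary ℂ θ)]; simp

/-- The antidual is a complex algebra under the convolution product. -/
instance Antidual.instAlgebra : Algebra ℂ (Antidual V) :=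
  Algebra.ofModule
    (fun c Φ Ψ => LinearMap.ext fun θ => by
      rw [LinearMap.smul_apply, Antidual.mul_repr _ _ (Coalgebra.Repr.arbitrary ℂ θ),
        Antidual.mul_repr _ _ (Coalgebra.Repr.arbitrary ℂ θ), Finset.smul_sum]
      simp [mul_assoc])
    (fun c Φ Ψ => LinearMap.ext fun θ => by
      rw [LinearMap.smul_apply, Antidual.mul_repr _ _ (Coalgebra.Repr.arbitrary ℂ θ),
        Antidual.mul_repr _ _ (Coalgebra.Repr.arbitrary ℂ θ), Finset.smul_sum]
      simp [mul_left_comm])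

/-- The coproduct of a product of vectors. -/
theorem comul_prod {κ : Type*} [DecidableEq κ] (s : Finset κ) (x : κ → V) :
    Coalgebra.comul (R := ℂ) (∏ i ∈ s, SymmetricAlgebra.ι ℂ V (x i)) =
      ∑ t ∈ s.powerset, (∏ i ∈ t, SymmetricAlgebra.ι ℂ V (x i)) ⊗ₜ[ℂ]
        (∏ i ∈ s \ t, SymmetricAlgebra.ι ℂ V (x i)) := by
  have h1 := map_prod (Bialgebra.comulAlgHom ℂ (Sym V))
    (fun i => SymmetricAlgebra.ι ℂ V (x i)) s
  simp only [Bialgebra.comulAlgHom_apply, SymmetricAlgebra.comul_ι] at h1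
  rw [h1, Finset.prod_add]
  refine Finset.sum_congr rfl fun t _ => ?_
  have h2 := map_prod (Algebra.TensorProduct.includeLeft (R := ℂ) (S := ℂ) (A := Sym V)
    (B := Sym V)) (fun i => SymmetricAlgebra.ι ℂ V (x i)) t
  have h3 := map_prod (Algebra.TensorProduct.includeRight (R := ℂ) (A := Sym V)
    (B := Sym V)) (fun i => SymmetricAlgebra.ι ℂ V (x i)) (s \ t)
  simp only [Algebra.TensorProduct.includeLeft_apply,
    Algebra.TensorProduct.includeRight_apply] at h2 h3
  rw [← h2, ← h3]
  simp

/-- The product of functionals on a product of vectors. -/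
theorem Antidual.mul_prod {κ : Type*} [DecidableEq κ] (Φ Ψ : Antidual V) (s : Finset κ)
    (x : κ → V) :
    (Φ * Ψ) (∏ i ∈ s, SymmetricAlgebra.ι ℂ V (x i)) =
      ∑ t ∈ s.powerset, Φ (∏ i ∈ t, SymmetricAlgebra.ι ℂ V (x i)) *
        Ψ (∏ i ∈ s \ t, SymmetricAlgebra.ι ℂ V (x i)) := by
  rw [Antidual.mul_apply, comul_prod, map_sum]
  rfl

/-- Projection of `SV` on its summand `V` of degree one. -/
def linPart : Sym V →ₗ[ℂ] V :=
  letI : Module ℂᵐᵒᵖ V := Module.compHom V ((RingHom.id ℂ).fromOpposite mul_comm)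
  haveI : IsCentralScalar ℂ V := ⟨fun _ _ => rfl⟩
  (TrivSqZeroExt.sndHom ℂ V).comp
    (SymmetricAlgebra.lift (TrivSqZeroExt.inrHom ℂ V)).toLinearMap

theorem linPart_ι (v : V) : linPart (SymmetricAlgebra.ι ℂ V v) = v := by
  simp [linPart]

theorem linPart_one : linPart (1 : Sym V) = 0 := by
  let _ : Module ℂᵐᵒᵖ V := Module.compHom V ((RingHom.id ℂ).fromOpposite mul_comm)
  have _ : IsCentralScalar ℂ V := ⟨fun _ _ => rfl⟩
  change (SymmetricAlgebra.lift (TrivSqZeroExt.inrHom ℂ V) 1).snd = 0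
  rw [map_one, TrivSqZeroExt.snd_one]

theorem linPart_mul (a b : Sym V) :
    linPart (a * b) = Coalgebra.counit (R := ℂ) a • linPart b +
      Coalgebra.counit (R := ℂ) b • linPart a := by
  let _ : Module ℂᵐᵒᵖ V := Module.compHom V ((RingHom.id ℂ).fromOpposite mul_comm)
  have _ : IsCentralScalar ℂ V := ⟨fun _ _ => rfl⟩
  have h : (TrivSqZeroExt.fstHom ℂ ℂ V).comp
      (SymmetricAlgebra.lift (TrivSqZeroExt.inrHom ℂ V)) = Bialgebra.counitAlgHom ℂ (Sym V) := by
    ext x; simp [SymmetricAlgebra.algebraMapInv_ι]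
  have h' : ∀ a : Sym V, (SymmetricAlgebra.lift (TrivSqZeroExt.inrHom ℂ V) a).fst =
    Coalgebra.counit (R := ℂ) a := fun a => congr($h a)
  simp [linPart, h']

/-- The functional `⟨· | v⟩` on `SV`, concentrated in degree one. -/
def vec : V →ₗ[ℂ] Antidual V where
  toFun v := ((innerₛₗ ℂ).flip v).comp linPart
  map_add' v w := by ext θ; simp
  map_smul' c v := by ext θ; simp

theorem vec_apply (v : V) (θ : Sym V) : vec v θ = inner ℂ (linPart θ) v := rfl

/-- The canonical algebra homomorphism `SV → SV'`, `φ ↦ ⟨· | φ⟩`. -/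
def incl : Sym V →ₐ[ℂ] Antidual V := SymmetricAlgebra.lift vec

/-- The standard inner product `⟨ψ | φ⟩` on `SV`, antilinear in `ψ` and linear in `φ`. It is
characterized by `symInner_prod` (permanents) and `symInner_prod_of_ne` (orthogonality of
distinct degrees). -/
def symInner (ψ φ : Sym V) : ℂ := incl φ ψ

theorem linPart_prod_eq_zero {κ : Type*} (s : Finset κ) (x : κ → V) (hs : s.card ≠ 1) :
    linPart (∏ i ∈ s, SymmetricAlgebra.ι ℂ V (x i)) = 0 := by
  classical
  induction s using Finset.induction_on with
  | empty => simpa using linPart_one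
  | insert a s ha ih =>
    rw [Finset.prod_insert ha, linPart_mul, SymmetricAlgebra.counit_ι, zero_smul, zero_add,
      linPart_ι]
    have hne : s.Nonempty := by
      rw [Finset.nonempty_iff_ne_empty]
      rintro rfl
      simp at hs
    obtain ⟨b, hb⟩ := hne
    have h1 := map_prod (Bialgebra.counitAlgHom ℂ (Sym V))
      (fun i => SymmetricAlgebra.ι ℂ V (x i)) s
    simp only [Bialgebra.counitAlgHom_apply, SymmetricAlgebra.counit_ι] at h1
    rw [h1, Finset.prod_const, zero_pow (Finset.card_ne_zero_of_mem hb), zero_smul]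

/-- Multiplication by `⟨· | v⟩` on a product of vectors. -/
theorem vec_mul_prod {κ : Type*} [DecidableEq κ] (v : V) (Ψ : Antidual V) (s : Finset κ)
    (x : κ → V) :
    (vec v * Ψ) (∏ i ∈ s, SymmetricAlgebra.ι ℂ V (x i)) =
      ∑ a ∈ s, inner ℂ (x a) v * Ψ (∏ i ∈ s.erase a, SymmetricAlgebra.ι ℂ V (x i)) := by
  rw [Antidual.mul_prod]
  have h : s.image (fun a => ({a} : Finset κ)) ⊆ s.powerset := by
    intro t ht
    obtain ⟨a, ha, rfl⟩ := Finset.mem_image.1 ht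
    simpa using ha
  rw [← Finset.sum_subset h, Finset.sum_image (by
    intro a _ b _ hab; exact Finset.singleton_injective hab)]
  · refine Finset.sum_congr rfl fun a _ => ?_
    rw [Finset.prod_singleton, vec_apply, linPart_ι, Finset.sdiff_singleton_eq_erase]
  · intro t ht ht'
    rw [vec_apply, linPart_prod_eq_zero, inner_zero_left, zero_mul]
    intro hc
    obtain ⟨a, rfl⟩ := Finset.card_eq_one.1 hc
    refine ht' (Finset.mem_image.2 ⟨a, ?_, rfl⟩)
    simpa using ht

theorem symInner_prod_of_ne_card {κ : Type*} (s : Finset κ) (x : κ → V) :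
    ∀ {e : ℕ} (y : Fin e → V), s.card ≠ e →
    symInner (∏ i ∈ s, SymmetricAlgebra.ι ℂ V (x i)) (∏ j, SymmetricAlgebra.ι ℂ V (y j)) = 0 := by
  classical
  intro e
  induction e generalizing s with
  | zero =>
    intro y hs
    simp only [symInner, Finset.univ_eq_empty, Finset.prod_empty, map_one, Antidual.one_apply]
    have h1 := map_prod (Bialgebra.counitAlgHom ℂ (Sym V))
      (fun i => SymmetricAlgebra.ι ℂ V (x i)) s
    simp only [Bialgebra.counitAlgHom_apply, SymmetricAlgebra.counit_ι] at h1
    rw [h1, Finset.prod_const, zero_pow hs, map_zero]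
  | succ e ih =>
    intro y hs
    rw [symInner, Fin.prod_univ_succ, map_mul, incl, SymmetricAlgebra.lift_ι_apply, vec_mul_prod]
    refine Finset.sum_eq_zero fun a ha => ?_
    have := ih (s.erase a) (fun j => y j.succ) (by
      intro hc
      exact hs (by rw [← Finset.card_erase_add_one ha, hc]))
    rw [symInner, incl] at this
    rw [this, mul_zero]

/-- Products of vectors of distinct degrees are perpendicular. -/
theorem symInner_prod_of_ne {d e : ℕ} (x : Fin d → V) (y : Fin e → V) (h : d ≠ e) :
    symInner (∏ i, SymmetricAlgebra.ι ℂ V (x i)) (∏ j, SymmetricAlgebra.ι ℂ V (y j)) = 0 :=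
  symInner_prod_of_ne_card _ _ _ (by simpa using h)

/-- The inner product of products of vectors is a permanent. -/
theorem symInner_prod {d : ℕ} (x y : Fin d → V) :
    symInner (∏ i, SymmetricAlgebra.ι ℂ V (x i)) (∏ j, SymmetricAlgebra.ι ℂ V (y j)) =
      (Matrix.of fun i j => inner ℂ (x i) (y j)).permanent := by
  induction d with
  | zero => rw [Matrix.permanent_isEmpty]; simp [symInner, Antidual.one_apply]
  | succ d ih =>
    rw [symInner, Fin.prod_univ_succ (fun j => SymmetricAlgebra.ι ℂ V (y j)), map_mul, incl,
      SymmetricAlgebra.lift_ι_apply, vec_mul_prod, Matrix.permanent,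
      ← Equiv.sum_comp Equiv.Perm.decomposeFin.symm, Fintype.sum_prod_type]
    refine Finset.sum_congr rfl fun p _ => ?_
    have h : ∏ i ∈ Finset.univ.erase p, SymmetricAlgebra.ι ℂ V (x i) =
        ∏ k : Fin d, SymmetricAlgebra.ι ℂ V (x (Equiv.swap 0 p k.succ)) := by
      have hm := Finset.prod_map Finset.univ
        ((Fin.succEmb d).trans (Equiv.swap 0 p).toEmbedding)
        (fun i => SymmetricAlgebra.ι ℂ V (x i))
      refine Eq.trans (Finset.prod_congr ?_ fun _ _ => rfl) hm
      ext i
      simp only [Finset.mem_erase, Finset.mem_univ, and_true, Finset.mem_map, true_and]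
      constructor
      · intro hi
        have h0 : Equiv.swap 0 p i ≠ 0 := by
          intro h0
          apply hi
          rw [← Equiv.swap_apply_self 0 p i, h0, Equiv.swap_apply_left]
        obtain ⟨k, hk⟩ := Fin.exists_succ_eq.2 h0
        exact ⟨k, by simp [hk]⟩
      · rintro ⟨k, rfl⟩ hp
        have : Equiv.swap 0 p k.succ = Equiv.swap 0 p 0 := by
          rw [Equiv.swap_apply_left]; exact hp
        exact Fin.succ_ne_zero k ((Equiv.swap 0 p).injective this)
    have := ih (fun k => x (Equiv.swap 0 p k.succ)) (fun k => y k.succ)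
    rw [symInner, incl] at this
    rw [h, this, Matrix.permanent, Finset.mul_sum]
    refine Finset.sum_congr rfl fun σ _ => ?_
    rw [Fin.prod_univ_succ]
    simp

theorem prod_induction {P : Sym V → Prop}
    (hprod : ∀ (d : ℕ) (x : Fin d → V), P (∏ i, SymmetricAlgebra.ι ℂ V (x i)))
    (hadd : ∀ a b, P a → P b → P (a + b)) (hsmul : ∀ (c : ℂ) a, P a → P (c • a))
    (a : Sym V) : P a := by
  let B : Set (Sym V) :=
    {z | ∃ (d : ℕ) (x : Fin d → V), z = ∏ i, SymmetricAlgebra.ι ℂ V (x i)}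
  have hB : ∀ a ∈ Submodule.span ℂ B, P a := by
    intro a ha
    induction ha using Submodule.span_induction with
    | mem z hz => obtain ⟨d, x, rfl⟩ := hz; exact hprod d x
    | zero => simpa using hsmul 0 _ (hprod 0 Fin.elim0)
    | add a b _ _ ha hb => exact hadd a b ha hb
    | smul c a _ ha => exact hsmul c a ha
  have h1 : (1 : Sym V) ∈ Submodule.span ℂ B :=
    Submodule.subset_span ⟨0, Fin.elim0, by simp⟩
  have hmul : Submodule.span ℂ B * Submodule.span ℂ B ≤ Submodule.span ℂ B := by
    rw [Submodule.span_mul_span]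
    refine Submodule.span_mono ?_
    rintro _ ⟨_, ⟨d, x, rfl⟩, _, ⟨e, y, rfl⟩, rfl⟩
    exact ⟨d + e, Fin.append x y, by simp [Fin.prod_univ_add]⟩
  refine hB a ?_
  induction a using SymmetricAlgebra.induction with
  | algebraMap r => rw [Algebra.algebraMap_eq_smul_one]; exact Submodule.smul_mem _ _ h1
  | ι x => exact Submodule.subset_span ⟨1, fun _ => x, by simp⟩
  | mul a b ha hb => exact hmul (Submodule.mul_mem_mul ha hb)
  | add a b ha hb => exact Submodule.add_mem _ ha hb

theorem symInner_add_right (ψ φ φ' : Sym V) :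
    symInner ψ (φ + φ') = symInner ψ φ + symInner ψ φ' := by simp [symInner]

theorem symInner_smul_right (c : ℂ) (ψ φ : Sym V) :
    symInner ψ (c • φ) = c * symInner ψ φ := by simp [symInner]

theorem symInner_add_left (ψ ψ' φ : Sym V) :
    symInner (ψ + ψ') φ = symInner ψ φ + symInner ψ' φ := by simp [symInner]

theorem symInner_smul_left (c : ℂ) (ψ φ : Sym V) :
    symInner (c • ψ) φ = conj c * symInner ψ φ := by simp [symInner]

theorem symInner_sum_right {κ : Type*} (s : Finset κ) (ψ : Sym V) (φ : κ → Sym V) :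
    symInner ψ (∑ k ∈ s, φ k) = ∑ k ∈ s, symInner ψ (φ k) := by simp [symInner]

theorem symInner_conj (ψ φ : Sym V) : conj (symInner ψ φ) = symInner φ ψ := by
  induction ψ using prod_induction with
  | hadd a b ha hb => rw [symInner_add_left, map_add, ha, hb, symInner_add_right]
  | hsmul c a ha => rw [symInner_smul_left, map_mul, ha, symInner_smul_right, Complex.conj_conj]
  | hprod d x =>
    induction φ using prod_induction with
    | hadd a b ha hb => rw [symInner_add_right, map_add, ha, hb, symInner_add_left]
    | hsmul c a ha => rw [symInner_smul_right, map_mul, ha, symInner_smul_left]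
    | hprod e y =>
      by_cases h : d = e
      · subst h
        rw [symInner_prod, symInner_prod, ← Matrix.permanent_transpose]
        simp [Matrix.permanent]
      · rw [symInner_prod_of_ne x y h, symInner_prod_of_ne y x (Ne.symm h), map_zero]

/-- The annihilator `a(v)` on `SV`. -/
def ann (v : V) : Sym V →ₗ[ℂ] Sym V :=
  (TensorProduct.lid ℂ (Sym V)).toLinearMap ∘ₗ
    TensorProduct.map ((innerₛₗ ℂ v) ∘ₗ linPart) LinearMap.id ∘ₗ Coalgebra.comul

theorem ann_one (v : V) : ann v (1 : Sym V) = 0 := by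
  simp [ann, Bialgebra.comul_one, Algebra.TensorProduct.one_def, linPart_one]

theorem ann_ι_mul (v w : V) (φ : Sym V) :
    ann v (SymmetricAlgebra.ι ℂ V w * φ) =
      inner ℂ v w • φ + SymmetricAlgebra.ι ℂ V w * ann v φ := by
  have r := Coalgebra.Repr.arbitrary ℂ φ
  have h := Coalgebra.sum_counit_smul r
  simp only [ann, LinearMap.comp_apply, Bialgebra.comul_mul, SymmetricAlgebra.comul_ι]
  rw [← r.eq, Finset.mul_sum]
  simp only [map_sum, add_mul, Algebra.TensorProduct.tmul_mul_tmul, one_mul, map_add,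
    TensorProduct.map_tmul, LinearMap.comp_apply, linPart_mul, linPart_ι,
    SymmetricAlgebra.counit_ι, zero_smul, zero_add, LinearMap.id_apply]
  simp only [LinearEquiv.coe_coe, TensorProduct.lid_tmul, Finset.sum_add_distrib, map_smul,
    smul_assoc, innerₛₗ_apply_apply, Finset.mul_sum, mul_smul_comm]
  congr 1
  conv_rhs => rw [← h, Finset.smul_sum]
  exact Finset.sum_congr rfl fun i _ => smul_comm _ _ _

/-- Annihilation is adjoint to multiplication. -/
theorem symInner_ι_mul (v : V) (ψ φ : Sym V) :
    symInner ψ (SymmetricAlgebra.ι ℂ V v * φ) = symInner (ann v ψ) φ := by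
  have r := Coalgebra.Repr.arbitrary ℂ ψ
  rw [symInner, map_mul, incl, SymmetricAlgebra.lift_ι_apply, Antidual.mul_repr _ _ r, ann]
  simp only [LinearMap.comp_apply]
  rw [← r.eq, symInner]
  simp [incl, vec_apply]

/-- `S^d M` as a subspace of `SV`: the span of all products of `d` vectors in `M`. -/
def symPow (M : Submodule ℂ V) (d : ℕ) : Submodule ℂ (Sym V) :=
  (M.map (SymmetricAlgebra.ι ℂ V)) ^ d

theorem symPow_zero_mem {M : Submodule ℂ V} {φ : Sym V} (h : φ ∈ symPow M 0) :
    ∃ c : ℂ, φ = c • (1 : Sym V) := by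
  rw [symPow, pow_zero, Submodule.mem_one] at h
  obtain ⟨c, rfl⟩ := h
  exact ⟨c, Algebra.algebraMap_eq_smul_one c⟩

theorem symPow_succ_induction {M : Submodule ℂ V} {d : ℕ} {P : Sym V → Prop}
    (hmul : ∀ v ∈ M, ∀ φ ∈ symPow M d, P (SymmetricAlgebra.ι ℂ V v * φ))
    (hadd : ∀ a b, P a → P b → P (a + b)) {φ : Sym V} (h : φ ∈ symPow M (d + 1)) : P φ := by
  rw [symPow, pow_succ'] at h
  refine Submodule.mul_induction_on h ?_ hadd
  rintro _ ⟨v, hv, rfl⟩ b hb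
  exact hmul v hv b hb

theorem ι_mul_mem_symPow {M : Submodule ℂ V} {d : ℕ} {v : V} (hv : v ∈ M) {φ : Sym V}
    (h : φ ∈ symPow M d) : SymmetricAlgebra.ι ℂ V v * φ ∈ symPow M (d + 1) := by
  rw [symPow, pow_succ']
  exact Submodule.mul_mem_mul (Submodule.mem_map_of_mem hv) h

theorem ann_mem_symPow {M : Submodule ℂ V} (v : V) {d : ℕ} {φ : Sym V}
    (h : φ ∈ symPow M (d + 1)) : ann v φ ∈ symPow M d := by
  induction d generalizing φ with
  | zero =>
    refine symPow_succ_induction (P := fun φ => ann v φ ∈ symPow M 0) ?_ ?_ h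
    · intro w _ φ hφ
      obtain ⟨c, hc⟩ := symPow_zero_mem hφ
      rw [ann_ι_mul, hc, map_smul, ann_one, smul_zero, mul_zero, add_zero, ← hc]
      exact Submodule.smul_mem _ _ hφ
    · intro a b ha hb
      rw [map_add]
      exact Submodule.add_mem _ ha hb
  | succ d ih =>
    refine symPow_succ_induction (P := fun φ => ann v φ ∈ symPow M (d + 1)) ?_ ?_ h
    · intro w hw φ hφ
      rw [ann_ι_mul]
      exact Submodule.add_mem _ (Submodule.smul_mem _ _ hφ) (ι_mul_mem_symPow hw (ih hφ))
    · intro a b ha hb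
      rw [map_add]
      exact Submodule.add_mem _ ha hb

theorem euler {M : Submodule ℂ V} {κ : Type*} [Fintype κ] (b : OrthonormalBasis κ ℂ M) {d : ℕ}
    {φ : Sym V} (h : φ ∈ symPow M d) :
    ∑ k, SymmetricAlgebra.ι ℂ V (b k) * ann (b k : V) φ = (d : ℂ) • φ := by
  induction d generalizing φ with
  | zero =>
    obtain ⟨c, rfl⟩ := symPow_zero_mem h
    simp [ann_one]
  | succ d ih =>
    refine symPow_succ_induction (P := fun φ => ∑ k, SymmetricAlgebra.ι ℂ V (b k) *
      ann (b k : V) φ = ((d + 1 : ℕ) : ℂ) • φ) ?_ ?_ h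
    · intro v hv φ hφ
      have h1 : ∑ k, inner ℂ (b k : V) v • (b k : V) = v := by
        have := congrArg (Subtype.val) (b.sum_repr' ⟨v, hv⟩)
        simpa using this
      have h2 : ∑ k, SymmetricAlgebra.ι ℂ V (b k) * (inner ℂ (b k : V) v • φ) =
          SymmetricAlgebra.ι ℂ V v * φ := by
        conv_rhs => rw [← h1]
        simp [Finset.sum_mul]
      simp only [ann_ι_mul, mul_add, Finset.sum_add_distrib, h2,
        mul_left_comm _ (SymmetricAlgebra.ι ℂ V v)]
      rw [← Finset.mul_sum, ih hφ]
      push_cast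
      rw [add_smul, one_smul, mul_smul_comm, add_comm]
    · intro a b ha hb
      simp only [map_add, mul_add, Finset.sum_add_distrib, ha, hb, smul_add]

theorem symInner_one : symInner (1 : Sym V) 1 = 1 := by
  simp [symInner, Antidual.one_apply]

/-- Positive definiteness of the inner product on `S^d M`. -/
theorem symInner_posDef (M : Submodule ℂ V) [FiniteDimensional ℂ M] {d : ℕ} {φ : Sym V}
    (h : φ ∈ symPow M d) :
    0 ≤ (symInner φ φ).re ∧ ((symInner φ φ).re = 0 → φ = 0) := by
  induction d generalizing φ with
  | zero =>
    obtain ⟨c, rfl⟩ := symPow_zero_mem h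
    rw [symInner_smul_left, symInner_smul_right, symInner_one, mul_one, ← Complex.normSq_eq_conj_mul_self,
      Complex.ofReal_re]
    exact ⟨Complex.normSq_nonneg c, fun hc => by rw [Complex.normSq_eq_zero.1 hc, zero_smul]⟩
  | succ d ih =>
    let b := stdOrthonormalBasis ℂ M
    have he := euler b h
    have h1 : ((d + 1 : ℕ) : ℝ) * (symInner φ φ).re =
        ∑ k, (symInner (ann (b k : V) φ) (ann (b k : V) φ)).re := by
      have := congrArg (fun z => (symInner φ z).re) he
      simp only [symInner_sum_right, symInner_ι_mul, symInner_smul_right] at this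
      rw [← Complex.re_sum, this, ← Complex.ofReal_natCast, Complex.re_ofReal_mul]
    have hk := fun k => ih (ann_mem_symPow (b k : V) h)
    have hd : (0 : ℝ) < ((d + 1 : ℕ) : ℝ) := by positivity
    constructor
    · refine nonneg_of_mul_nonneg_right ?_ hd
      rw [h1]
      exact Finset.sum_nonneg fun k _ => (hk k).1
    · intro h0
      rw [h0, mul_zero] at h1
      have h2 := (Finset.sum_eq_zero_iff_of_nonneg fun k _ => (hk k).1).1 h1.symm
      have h3 : ((d + 1 : ℕ) : ℂ) • φ = 0 := by
        rw [← he]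
        exact Finset.sum_eq_zero fun k hk' => by rw [(hk k).2 (h2 k hk'), mul_zero]
      exact (smul_eq_zero.1 h3).resolve_left (Nat.cast_ne_zero.2 (Nat.succ_ne_zero d))

/-- The inner product on `S^d M`. -/
@[reducible] def symPowCore (M : Submodule ℂ V) [FiniteDimensional ℂ M] (d : ℕ) :
    InnerProductSpace.Core ℂ (symPow M d) where
  inner ψ φ := symInner (ψ : Sym V) (φ : Sym V)
  conj_inner_symm ψ φ := symInner_conj _ _
  re_inner_nonneg φ := (symInner_posDef M φ.2).1
  add_left ψ ψ' φ := symInner_add_left _ _ _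
  smul_left ψ φ c := symInner_smul_left _ _ _
  definite φ h := Subtype.ext ((symInner_posDef M φ.2).2 (by
    change symInner (φ : Sym V) (φ : Sym V) = 0 at h
    rw [h, Complex.zero_re]))

/-- An antilinear functional on `SV` is represented on `S^d M` by a unique element of `S^d M`. -/
theorem existsUnique_component (Φ : Antidual V) (M : Submodule ℂ V) [FiniteDimensional ℂ M]
    (d : ℕ) : ∃! φ : Sym V, φ ∈ symPow M d ∧ ∀ ψ ∈ symPow M d, Φ ψ = symInner ψ φ := by
  have hfin : FiniteDimensional ℂ (symPow M d) := by
    rw [← Submodule.fg_iff_finiteDimensional]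
    exact (Submodule.FG.map _ ((Submodule.fg_iff_finiteDimensional M).2 inferInstance)).pow d
  let core := symPowCore M d
  let _ : NormedAddCommGroup (symPow M d) := core.toNormedAddCommGroup
  let _ : InnerProductSpace ℂ (symPow M d) := InnerProductSpace.ofCore core.toCore
  have _ : CompleteSpace (symPow M d) := FiniteDimensional.complete ℂ _
  let F : symPow M d →ₗ[ℂ] ℂ :=
    (starLinearEquiv ℂ (A := ℂ)).toLinearMap.comp (Φ.comp (symPow M d).subtype)
  let φ := (InnerProductSpace.toDual ℂ (symPow M d)).symm (LinearMap.toContinuousLinearMap F)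
  have hφ : ∀ ψ : symPow M d, symInner (φ : Sym V) (ψ : Sym V) = conj (Φ ψ) := fun ψ =>
    InnerProductSpace.toDual_symm_apply (x := ψ) (y := LinearMap.toContinuousLinearMap F)
  refine ⟨φ, ⟨φ.2, fun ψ hψ => ?_⟩, ?_⟩
  · rw [← symInner_conj, hφ ⟨ψ, hψ⟩, Complex.conj_conj]
  · rintro χ ⟨hχ, h⟩
    have hmem : χ - (φ : Sym V) ∈ symPow M d := Submodule.sub_mem _ hχ φ.2
    have h1 : symInner (χ - (φ : Sym V)) (χ - (φ : Sym V)) = 0 := by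
      have e1 := h _ hmem
      have e2 := hφ ⟨_, hmem⟩
      have e3 : symInner (χ - (φ : Sym V)) (φ : Sym V) = Φ (χ - (φ : Sym V)) := by
        rw [← symInner_conj, e2, Complex.conj_conj]
      have e4 : symInner (χ - (φ : Sym V)) (χ - (φ : Sym V)) =
          symInner (χ - (φ : Sym V)) χ - symInner (χ - (φ : Sym V)) (φ : Sym V) := by
        simp [symInner]
      rw [e4, e3, ← e1, sub_self]
    exact sub_eq_zero.1 ((symInner_posDef M hmem).2 (by rw [h1, Complex.zero_re]))

/-- The component `Φ_M^d`: the unique element of `S^d M` with `Φ = ⟨· | Φ_M^d⟩` on `S^d M`. -/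
def component (Φ : Antidual V) (M : Submodule ℂ V) [FiniteDimensional ℂ M] (d : ℕ) : Sym V :=
  (existsUnique_component Φ M d).choose

theorem component_spec (Φ : Antidual V) (M : Submodule ℂ V) [FiniteDimensional ℂ M] (d : ℕ) :
    component Φ M d ∈ symPow M d ∧
      ∀ ψ ∈ symPow M d, Φ ψ = symInner ψ (component Φ M d) :=
  (existsUnique_component Φ M d).choose_spec.1

/-- `‖Φ_M‖ ∈ [0, ∞]`, where `‖Φ_M‖² = ∑_d ‖Φ_M^d‖²`. -/
def normOn (Φ : Antidual V) (M : Submodule ℂ V) [FiniteDimensional ℂ M] : ℝ≥0∞ :=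
  (∑' d : ℕ, ENNReal.ofReal (symInner (component Φ M d) (component Φ M d)).re) ^ (1 / 2 : ℝ)

/-- `‖Φ‖ ∈ [0, ∞]`: the supremum of `‖Φ_M‖` over the finite-dimensional subspaces `M`. -/
def fockNorm (Φ : Antidual V) : ℝ≥0∞ :=
  ⨆ (M : Submodule ℂ V) (_ : FiniteDimensional ℂ M), normOn Φ M

variable (V) in
/-- Symmetric Fock space `S[V]`. -/
def fockSpace : Set (Antidual V) := {Φ | fockNorm Φ < ∞}

/-- The quadratic attached to a (symmetric) antilinear map `Z : V → V'`. For symmetric `Z` it is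
the functional that vanishes off degree two and satisfies `ζ(xy) = Zx(y)`; see
`quadratic_ι_mul_ι` and `quadratic_prod_of_ne`. -/
def quadratic (Z : V →ₗ⋆[ℂ] V →ₗ⋆[ℂ] ℂ) : Antidual V :=
  (2⁻¹ : ℂ) • ((TensorProduct.lift Z).comp
    (TensorProduct.map (linPart (V := V)) (linPart (V := V)) ∘ₗ Coalgebra.comul))

theorem quadratic_ι_mul_ι (Z : V →ₗ⋆[ℂ] V →ₗ⋆[ℂ] ℂ) (hZ : ∀ x y, Z x y = Z y x) (x y : V) :
    quadratic Z (SymmetricAlgebra.ι ℂ V x * SymmetricAlgebra.ι ℂ V y) = Z x y := by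
  simp [quadratic, Bialgebra.comul_mul, add_mul, mul_add, linPart_mul, linPart_ι, linPart_one]
  rw [hZ y x]
  ring

theorem quadratic_prod_of_ne (Z : V →ₗ⋆[ℂ] V →ₗ⋆[ℂ] ℂ) {d : ℕ} (hd : d ≠ 2) (x : Fin d → V) :
    quadratic Z (∏ i, SymmetricAlgebra.ι ℂ V (x i)) = 0 := by
  rw [quadratic, LinearMap.smul_apply, LinearMap.comp_apply, LinearMap.comp_apply, comul_prod]
  simp only [map_sum, TensorProduct.map_tmul, TensorProduct.lift.tmul]
  rw [Finset.sum_eq_zero, smul_zero]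
  intro t ht
  by_cases h1 : t.card = 1
  · rw [linPart_prod_eq_zero (Finset.univ \ t), map_zero]
    have h2 := Finset.card_sdiff_add_card_eq_card (Finset.mem_powerset.1 ht)
    rw [Finset.card_univ, Fintype.card_fin] at h2
    omega
  · rw [linPart_prod_eq_zero t _ h1, map_zero, LinearMap.zero_apply]

theorem quadratic_one (Z : V →ₗ⋆[ℂ] V →ₗ⋆[ℂ] ℂ) : quadratic Z 1 = 0 := by
  simpa using quadratic_prod_of_ne Z (d := 0) (by norm_num) Fin.elim0

theorem pow_prod_eq_zero {κ : Type*} [DecidableEq κ] {Φ : Antidual V} (hΦ : Φ 1 = 0) {n : ℕ}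
    (s : Finset κ) (x : κ → V) (hs : s.card < n) :
    (Φ ^ n) (∏ i ∈ s, SymmetricAlgebra.ι ℂ V (x i)) = 0 := by
  induction n generalizing s with
  | zero => exact absurd hs (Nat.not_lt_zero _)
  | succ n ih =>
    rw [pow_succ', Antidual.mul_prod]
    refine Finset.sum_eq_zero fun t ht => ?_
    rcases t.eq_empty_or_nonempty with rfl | hne
    · simp [hΦ]
    · rw [ih (s \ t), mul_zero]
      have h1 := Finset.card_sdiff_add_card_eq_card (Finset.mem_powerset.1 ht)
      have h2 := hne.card_pos
      omega

/-- The powers of a functional that vanishes in degree zero are locally finite. -/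
theorem finite_support_pow {Φ : Antidual V} (hΦ : Φ 1 = 0) (ψ : Sym V) :
    (Function.support fun n : ℕ => ((n.factorial : ℂ)⁻¹ • Φ ^ n) ψ).Finite := by
  suffices h : ∃ N, ∀ n, N < n → (Φ ^ n) ψ = 0 by
    obtain ⟨N, hN⟩ := h
    refine (Set.finite_Iic N).subset fun n hn => ?_
    by_contra hlt
    exact hn (by
      change ((n.factorial : ℂ)⁻¹ • Φ ^ n) ψ = 0
      rw [LinearMap.smul_apply, hN n (not_le.1 hlt), smul_zero])
  induction ψ using prod_induction with
  | hprod d x =>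
    refine ⟨d, fun n hn => pow_prod_eq_zero hΦ _ _ ?_⟩
    simpa using hn
  | hadd a b ha hb =>
    obtain ⟨N, hN⟩ := ha
    obtain ⟨K, hK⟩ := hb
    refine ⟨max N K, fun n hn => ?_⟩
    rw [map_add, hN n (lt_of_le_of_lt (le_max_left _ _) hn),
      hK n (lt_of_le_of_lt (le_max_right _ _) hn), add_zero]
  | hsmul c a ha =>
    obtain ⟨N, hN⟩ := ha
    refine ⟨N, fun n hn => ?_⟩
    rw [LinearMap.map_smulₛₗ, hN n hn, smul_zero]

/-- The Gaussian `e^Z = exp ζ = ∑ₙ ζⁿ / n!`, where `ζ` is the quadratic attached to `Z`; the sum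
is finite on each element of `SV`, by `finite_support_pow`. -/
def gaussian (Z : V →ₗ⋆[ℂ] V →ₗ⋆[ℂ] ℂ) : Antidual V where
  toFun ψ := ∑ᶠ n : ℕ, ((n.factorial : ℂ)⁻¹ • quadratic Z ^ n) ψ
  map_add' a b := by
    rw [← finsum_add_distrib (finite_support_pow (quadratic_one Z) a)
      (finite_support_pow (quadratic_one Z) b)]
    exact finsum_congr fun n => map_add _ _ _
  map_smul' c a := by
    rw [smul_finsum' _ (finite_support_pow (quadratic_one Z) a)]
    exact finsum_congr fun n => LinearMap.map_smulₛₗ _ _ _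

/-- A bounded antilinear operator is Hilbert–Schmidt when `∑ ‖T bᵢ‖²` converges for some
(equivalently, any) orthonormal basis. -/
def IsHilbertSchmidt (T : V →L⋆[ℂ] V) : Prop :=
  ∃ (w : Set V) (b : HilbertBasis w ℂ V), Summable fun i => ‖T (b i)‖ ^ 2

open Classical in
/-- `D` is the Fredholm determinant `Det B` of `B = I + A`, in the sense of the Fredholm series
`Det (I + A) = ∑ₖ Tr Λᵏ A`: for each orthonormal basis `b`, the principal minors
`det [⟨bᵢ | A bⱼ⟩]_{i, j ∈ S}` over all finite sets `S` of indices are summable with sum `D`. -/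
def IsFredholmDet (B : V →L[ℂ] V) (D : ℂ) : Prop :=
  ∀ (w : Set V) (b : HilbertBasis w ℂ V),
    HasSum (fun S : Finset w =>
      (Matrix.of fun i j : S => inner ℂ (b i) ((B - 1) (b j))).det) D

end Defs

end Fock

end

/-!
The Gaussian `e^Z` is computed on one finite-dimensional subspace `M` at a time. By Takagi
factorization (`exists_takagi_basis`), `Z` is diagonal, with entries `lₖ ≥ 0`, in some orthonormal
basis `cₖ` of `M`. The components of `e^Z` in `M` are then the terms of `exp (½ ∑ lₖ cₖ²)`, and
because powers of perpendicular vectors multiply orthogonally, the norm factors into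
one-dimensional series `∑ⱼ C(2j, j) (lₖ² / 4)^j = (1 - lₖ²)^(-1/2)`. Squaring once more turns these
into geometric series and avoids square roots: `‖(e^Z)_M‖⁴ = ∏ₖ (1 - lₖ²)⁻¹`, where both sides are
`∞` as soon as some `lₖ ≥ 1` (`normOn_gaussian_pow_four`).

If `‖e^Z‖` is finite, this formula bounds all `lₖ` by some `r < 1` and all sums `∑ lₖ²` by a
constant, uniformly in `M`. The first bound makes `Z` a bounded form of norm at most `r`, hence an
operator `T`; the second makes `T` Hilbert–Schmidt
(`exists_hilbertSchmidt_of_fockNorm_lt_top`).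

Conversely, let `Z` be given by a Hilbert–Schmidt operator `T` with `‖T‖ < 1`. What has to be
shown is that the Fredholm series of `1 - T²` converges, in every orthonormal basis, to the infimum
over `M` of the numbers `∏ₖ (1 - lₖ²)` (`exists_fredholmDet`). For a finite set `F` of basis
vectors, the principal minors of `-T²` inside `F` add up to `det (1 - (T²)_F)`, where `(T²)_F` is
the compression of `T²` to the span of `F`; as the minors of `T²` are nonnegative and
`det (1 + (T²)_F) ≤ exp (tr T²)`, the series converges absolutely, to the limit of
`det (1 - (T²)_F)`. Two comparisons identify that limit.

* For every `F`, the subspace `M` spanned by `F` and `T F` has `∏ₖ (1 - lₖ²) ≤ det (1 - (T²)_F)`,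
  since `(T²)_F` is also the compression of `(T_M)²`, and compressing a positive contraction
  increases its determinant (`prod_le_det_one_sub_sqMatrix`).
* For every `M`, the limit is at most `∏ₖ (1 - lₖ²)`: the basis of `M` is approximated by its
  projections to the spans of the sets `F`, and compressing `T` before squaring decreases `T²`
  (`le_det_one_sub_sqMatrix`, `det_one_sub_sqMatrix_le`).

Both rest on the matrix inequality `det B · det (Xᴴ X) ≤ det (Xᴴ B X)` for `0 ≤ B ≤ 1`
(`det_mul_det_gram_le`). As the infimum does not refer to a basis, neither does the limit.
-/

open scoped TensorProduct ENNReal ComplexConjugate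

/-! ### Determinants of positive matrices -/

namespace Fock

section Matrices

open scoped ComplexOrder
open Matrix

variable {m n : Type*} [Fintype m] [DecidableEq m] [Fintype n] [DecidableEq n]

theorem det_one_add_eq_sum_minors (A : Matrix n n ℂ) :
    (1 + A).det = ∑ s : Finset n, (A.submatrix (Subtype.val : s → n) Subtype.val).det := by
  let D := (detRowAlternating : (n → ℂ) [⋀^n]→ₗ[ℂ] ℂ)
  have h : (1 + A).det = ∑ s : Finset n, D (s.piecewise A (1 : Matrix n n ℂ)) := by
    rw [add_comm]
    exact D.map_add_univ (fun i => A i) (fun i => (1 : Matrix n n ℂ) i)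
  rw [h]
  exact Finset.sum_congr rfl fun s _ => det_piecewise_one_eq_submatrix_det A s

/-- The principal minors of a finite block of an infinite matrix, as sums over finite subsets. -/
theorem det_one_add_finset {κ : Type*} [DecidableEq κ] (A : κ → κ → ℂ) (F : Finset κ) :
    (1 + Matrix.of fun i j : F => A i j).det =
      ∑ S ∈ F.powerset, (Matrix.of fun i j : S => A i j).det := by
  rw [det_one_add_eq_sum_minors]
  refine Finset.sum_bij (fun s _ => s.map (Function.Embedding.subtype _)) ?_ ?_ ?_ ?_
  · intro s _
    rw [Finset.mem_powerset]
    intro x hx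
    obtain ⟨y, _, rfl⟩ := Finset.mem_map.1 hx
    exact y.2
  · intro s _ t _ h
    exact Finset.map_injective _ h
  · intro S hS
    rw [Finset.mem_powerset] at hS
    refine ⟨S.subtype (· ∈ F), Finset.mem_univ _, ?_⟩
    rw [Finset.subtype_map, Finset.filter_true_of_mem hS]
  · intro s _
    let e : s ≃ (s.map (Function.Embedding.subtype (· ∈ F)) : Finset κ) := 
      Equiv.ofBijective (fun x => ⟨x, Finset.mem_map_of_mem _ x.2⟩)
        ⟨fun x y h => Subtype.ext (Subtype.ext (Subtype.mk.inj h)), fun y => by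
          obtain ⟨x, hx, hxy⟩ := Finset.mem_map.1 y.2
          exact ⟨⟨x, hx⟩, Subtype.ext hxy⟩⟩
    rw [← det_submatrix_equiv_self e]
    rfl

theorem one_le_det_one_add {A : Matrix n n ℂ} (hA : A.PosSemidef) : 1 ≤ (1 + A).det := by
  rw [det_one_add_eq_sum_minors, ← Finset.add_sum_erase _ _ (Finset.mem_univ ∅)]
  rw [show (A.submatrix (Subtype.val : (∅ : Finset n) → n) Subtype.val).det = 1 from
    det_isEmpty]
  exact le_add_of_nonneg_right (Finset.sum_nonneg fun s _ => (hA.submatrix _).det_nonneg)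

/-- The determinant is monotone on positive matrices. -/
theorem det_le_det_add {A E : Matrix n n ℂ} (hA : A.PosDef) (hE : E.PosSemidef) :
    A.det ≤ (A + E).det := by
  obtain ⟨R, rfl⟩ : ∃ R : Matrix n n ℂ, E = Rᴴ * R := by
    open scoped MatrixOrder in
    exact CStarAlgebra.nonneg_iff_eq_star_mul_self.mp hE.nonneg
  have hu : IsUnit A.det := (isUnit_iff_isUnit_det A).1 hA.isUnit
  have h1 : A + Rᴴ * R = A * (1 + A⁻¹ * Rᴴ * R) := by
    rw [mul_add, mul_one, mul_assoc, mul_nonsing_inv_cancel_left _ _ hu]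
  rw [h1, det_mul, det_one_add_mul_comm, ← mul_assoc]
  refine le_mul_of_one_le_right hA.det_pos.le (one_le_det_one_add ?_)
  exact hA.inv.posSemidef.mul_mul_conjTranspose_same R

/-- The determinant is monotone on positive semidefinite matrices. -/
theorem det_le_det_of_posSemidef_sub {A B : Matrix n n ℂ} (hA : A.PosSemidef)
    (hE : (B - A).PosSemidef) : A.det ≤ B.det := by
  by_cases h : A.det = 0
  · rw [h]
    have := (hA.add hE).det_nonneg
    rwa [add_sub_cancel] at this
  · have := det_le_det_add (hA.posDef_iff_det_ne_zero.2 h) hE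
    rwa [add_sub_cancel] at this

/-- Sylvester's identity with a parameter `ε`. -/
theorem pow_mul_det_add_mul_comm (ε : ℂ) (hε : ε ≠ 0) (A : Matrix n m ℂ) (B : Matrix m n ℂ) :
    ε ^ Fintype.card m * (ε • (1 : Matrix n n ℂ) + A * B).det =
      ε ^ Fintype.card n * (ε • (1 : Matrix m m ℂ) + B * A).det := by
  have h1 : ε • (1 : Matrix n n ℂ) + A * B = ε • (1 + (ε⁻¹ • A) * B) := by
    rw [smul_add, smul_mul, smul_smul, mul_inv_cancel₀ hε, one_smul]
  have h2 : ε • (1 : Matrix m m ℂ) + B * A = ε • (1 + B * (ε⁻¹ • A)) := by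
    rw [smul_add, Matrix.mul_smul, smul_smul, mul_inv_cancel₀ hε, one_smul]
  rw [h1, h2, det_smul, det_smul, det_one_add_mul_comm]
  ring

/-- The regularized form of `det_mul_det_gram_le`. By Sylvester's identity, with `R = B^(1/2)`, both
determinants become determinants of size `n`, where `R (ε + X Xᴴ) R ≤ ε + R X Xᴴ R`. -/
theorem det_mul_det_gram_add_le {B : Matrix n n ℂ} (hB : B.PosSemidef) (hB1 : (1 - B).PosSemidef)
    (X : Matrix n m ℂ) {ε : ℝ} (hε : 0 < ε) :
    B.det * ((ε : ℂ) • 1 + Xᴴ * X).det ≤ ((ε : ℂ) • 1 + Xᴴ * B * X).det := by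
  have hε' : (ε : ℂ) ≠ 0 := by exact_mod_cast hε.ne'
  have hε0 : (0 : ℂ) ≤ ε := by exact_mod_cast hε.le
  obtain ⟨R, hRH, hR⟩ : ∃ R : Matrix n n ℂ, Rᴴ = R ∧ R * R = B := by
    open scoped MatrixOrder in
    exact ⟨CFC.sqrt B, (CFC.sqrt_nonneg B).posSemidef.isHermitian,
      CFC.sqrt_mul_sqrt_self B hB.nonneg⟩
  have hpos : (0 : ℂ) < (ε : ℂ) ^ Fintype.card n := by
    exact_mod_cast pow_pos hε _
  have hpos' : (0 : ℂ) ≤ (ε : ℂ) ^ Fintype.card m := by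
    exact_mod_cast pow_nonneg hε.le _
  have h1 := pow_mul_det_add_mul_comm (ε : ℂ) hε' Xᴴ X
  have h2 := pow_mul_det_add_mul_comm (ε : ℂ) hε' (Xᴴ * R) (R * X)
  have h3 : Xᴴ * R * (R * X) = Xᴴ * B * X := by rw [← hR]; simp only [Matrix.mul_assoc]
  rw [h3] at h2
  have h4 : R * ((ε : ℂ) • 1 + X * Xᴴ) * R = (ε : ℂ) • B + R * X * (Xᴴ * R) := by
    rw [mul_add, add_mul, Matrix.mul_smul, Matrix.smul_mul, mul_one, hR]
    simp only [Matrix.mul_assoc]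
  have h5 : B.det * ((ε : ℂ) • 1 + X * Xᴴ).det ≤ ((ε : ℂ) • 1 + R * X * (Xᴴ * R)).det := by
    have h6 : B.det * ((ε : ℂ) • 1 + X * Xᴴ).det =
        (R * ((ε : ℂ) • 1 + X * Xᴴ) * R).det := by
      rw [det_mul, det_mul, ← hR, det_mul]; ring
    rw [h6, h4]
    refine det_le_det_of_posSemidef_sub ?_ ?_
    · refine (hB.smul hε0).add ?_
      have := posSemidef_self_mul_conjTranspose (R * X)
      rwa [conjTranspose_mul, hRH] at this
    · rw [add_sub_add_right_eq_sub, ← smul_sub]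
      exact hB1.smul hε0
  refine le_of_mul_le_mul_left ?_ hpos
  rw [h2, mul_left_comm, h1, mul_left_comm]
  exact mul_le_mul_of_nonneg_left h5 hpos'

/-- Compressing a positive contraction `B` along `X` (so `Xᴴ B X` replaces `B`, and `Xᴴ X`
replaces the identity) can only increase the determinant relative to the Gram determinant. For
isometric `X` this says that compressing to a subspace increases the determinant. -/
theorem det_mul_det_gram_le {B : Matrix n n ℂ} (hB : B.PosSemidef) (hB1 : (1 - B).PosSemidef)
    (X : Matrix n m ℂ) : B.det * (Xᴴ * X).det ≤ (Xᴴ * B * X).det := by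
  have key : ∀ A : Matrix m m ℂ, Filter.Tendsto (fun ε : ℝ => ((ε : ℂ) • 1 + A).det)
      (nhdsWithin 0 (Set.Ioi 0)) (nhds A.det) := by
    intro A
    have hc : Continuous fun ε : ℝ => ((ε : ℂ) • 1 + A).det := by fun_prop
    have := hc.tendsto 0
    rw [Complex.ofReal_zero, zero_smul, zero_add] at this
    exact this.mono_left nhdsWithin_le_nhds
  refine le_of_tendsto_of_tendsto ((key (Xᴴ * X)).const_mul B.det) (key (Xᴴ * B * X)) ?_
  filter_upwards [self_mem_nhdsWithin] with ε hε
  exact det_mul_det_gram_add_le hB hB1 X hε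

/-- The determinant of `1 + K`, for positive `K`, is at most the exponential of the trace. -/
theorem det_one_add_re_le_exp {K : Matrix n n ℂ} (hK : K.PosSemidef) :
    (1 + K).det.re ≤ Real.exp K.trace.re := by
  have h1 : (1 + K).det = ((∏ i, (1 + hK.1.eigenvalues i) : ℝ) : ℂ) := by
    have h := hK.1.charpoly_eq
    have h2 := congrArg (Polynomial.eval (-1)) h
    rw [Matrix.eval_charpoly, Polynomial.eval_prod] at h2
    have h3 : Matrix.scalar n (-1 : ℂ) - K = -(1 + K) := by
      rw [map_neg, map_one]; abel
    rw [h3, det_neg] at h2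
    have h4 : ∏ j, Polynomial.eval (-1)
        (Polynomial.X - Polynomial.C ((hK.1.eigenvalues j : ℝ) : ℂ)) =
        (-1) ^ Fintype.card n * ∏ j, (1 + (hK.1.eigenvalues j : ℂ)) := by
      rw [← Finset.card_univ, ← Finset.prod_const, ← Finset.prod_mul_distrib]
      refine Finset.prod_congr rfl fun j _ => ?_
      simp; ring
    have h5 := h2.trans h4
    have h6 := mul_left_cancel₀ (pow_ne_zero _ (by norm_num)) h5
    rw [h6]; push_cast; rfl
  have h7 : K.trace.re = ∑ i, hK.1.eigenvalues i := by
    rw [hK.1.trace_eq_sum_eigenvalues]; simp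
  rw [h1, Complex.ofReal_re, h7, Real.exp_sum]
  refine Finset.prod_le_prod (fun i _ => by have := hK.eigenvalues_nonneg i; positivity)
    fun i _ => ?_
  rw [add_comm]
  exact Real.add_one_le_exp _

end Matrices

/-! ### Takagi factorization -/

section Takagi

variable {V : Type*} [NormedAddCommGroup V] [InnerProductSpace ℂ V]

/-- In finite dimension, an antilinear map to the antidual is an antilinear operator. -/
theorem exists_operator [FiniteDimensional ℂ V] (Z : V →ₗ⋆[ℂ] V →ₗ⋆[ℂ] ℂ) :
    ∃ T : V →ₗ⋆[ℂ] V, ∀ x y, Z x y = inner ℂ y (T x) := by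
  let b := stdOrthonormalBasis ℂ V
  refine ⟨{ toFun := fun x => ∑ k, Z x (b k) • b k
            map_add' := fun x y => by simp [add_smul, Finset.sum_add_distrib]
            map_smul' := fun a x => by simp [mul_smul, Finset.smul_sum] }, fun x y => ?_⟩
  conv_lhs => rw [← b.sum_repr' y]
  simp [mul_comm]

/-- An antilinear symmetric operator `T` has a unit vector `v` with `T v = l v` and `l ≥ 0`: if
`T² v = r² v`, then either `T v + r v` or `i v` is such a vector, up to normalization. -/
theorem exists_takagi_vector [FiniteDimensional ℂ V] [Nontrivial V] (Z : V →ₗ⋆[ℂ] V →ₗ⋆[ℂ] ℂ)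
    (hZ : ∀ x y, Z x y = Z y x) :
    ∃ (v : V) (l : ℝ), ‖v‖ = 1 ∧ 0 ≤ l ∧ ∀ y, Z v y = l * inner ℂ y v := by
  obtain ⟨T, hT⟩ := exists_operator Z
  suffices h : ∃ (u : V) (r : ℝ), u ≠ 0 ∧ 0 ≤ r ∧ T u = (r : ℂ) • u by
    obtain ⟨u, r, hu, hr, hTu⟩ := h
    refine ⟨((‖u‖⁻¹ : ℝ) : ℂ) • u, r, ?_, hr, fun y => ?_⟩
    · rw [norm_smul, Complex.norm_real, norm_inv, norm_norm,
        inv_mul_cancel₀ (norm_ne_zero_iff.2 hu)]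
    · rw [hT, LinearMap.map_smulₛₗ, hTu, Complex.conj_ofReal, inner_smul_right, inner_smul_right,
        inner_smul_right]
      ring
  obtain ⟨μ, hμ⟩ := Module.End.exists_eigenvalue (T.comp T : V →ₗ[ℂ] V)
  obtain ⟨v, hv⟩ := hμ.exists_hasEigenvector
  have hv0 : ‖v‖ ≠ 0 := norm_ne_zero_iff.2 hv.2
  have hvT : T (T v) = μ • v := hv.apply_eq_smul
  have h1 : μ * (‖v‖ : ℂ) ^ 2 = (‖T v‖ : ℂ) ^ 2 := by
    have e1 : inner ℂ v v = (‖v‖ : ℂ) ^ 2 := inner_self_eq_norm_sq_to_K v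
    have e2 : inner ℂ (T v) (T v) = (‖T v‖ : ℂ) ^ 2 := inner_self_eq_norm_sq_to_K _
    rw [← e1, ← e2, ← inner_smul_right, ← hvT, ← hT, hZ, hT]
  set r : ℝ := ‖T v‖ / ‖v‖ with hr
  have hr0 : 0 ≤ r := by positivity
  have h2 : μ = (r : ℂ) * r := by
    have : (‖v‖ : ℂ) ≠ 0 := by exact_mod_cast hv0
    rw [hr]; push_cast; field_simp; exact h1
  by_cases hu : T v + (r : ℂ) • v = 0
  · refine ⟨Complex.I • v, r, smul_ne_zero Complex.I_ne_zero hv.2, hr0, ?_⟩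
    rw [LinearMap.map_smulₛₗ, eq_neg_of_add_eq_zero_left hu, Complex.conj_I, smul_neg, neg_smul,
      neg_neg, smul_comm]
  · refine ⟨_, r, hu, hr0, ?_⟩
    rw [map_add, LinearMap.map_smulₛₗ, hvT, h2, Complex.conj_ofReal, smul_add, smul_smul, add_comm]

theorem exists_takagi_family (Z : V →ₗ⋆[ℂ] V →ₗ⋆[ℂ] ℂ) (hZ : ∀ x y, Z x y = Z y x) (n : ℕ)
    (M : Submodule ℂ V) [FiniteDimensional ℂ M] (hM : Module.finrank ℂ M = n) :
    ∃ (c : Fin n → V) (l : Fin n → ℝ), Orthonormal ℂ c ∧ (∀ k, c k ∈ M) ∧ (∀ k, 0 ≤ l k) ∧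
      ∀ k j, Z (c k) (c j) = if k = j then (l k : ℂ) else 0 := by
  induction n generalizing M with
  | zero => exact ⟨Fin.elim0, Fin.elim0, ⟨fun k => k.elim0, fun k => k.elim0⟩,
      fun k => k.elim0, fun k => k.elim0, fun k => k.elim0⟩
  | succ n ih =>
    have : Nontrivial M := Module.nontrivial_of_finrank_pos (R := ℂ) (by omega)
    obtain ⟨v, r, hv, hr, hvZ⟩ :=
      exists_takagi_vector (Z.domRestrict₁₂ M M) (fun x y => hZ x y)
    have hv' : ‖(v : V)‖ = 1 := hv
    have hvZ' : ∀ y ∈ M, Z v y = r * inner ℂ y (v : V) := fun y hy => hvZ ⟨y, hy⟩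
    have hle : Submodule.span ℂ {(v : V)} ≤ M := by
      rw [Submodule.span_singleton_le_iff_mem]; exact v.2
    have hrank := Submodule.finrank_add_inf_finrank_orthogonal hle
    rw [hM, finrank_span_singleton (norm_ne_zero_iff.1 (by rw [hv']; exact one_ne_zero))] at hrank
    obtain ⟨c, l, hc, hcM, hl, hZc⟩ := ih _ (by omega : Module.finrank ℂ
      ((Submodule.span ℂ {(v : V)})ᗮ ⊓ M : Submodule ℂ V) = n)
    have hperp : ∀ k, inner ℂ (c k) (v : V) = 0 := fun k =>
      Submodule.mem_orthogonal_singleton_iff_inner_left.1 (hcM k).1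
    refine ⟨Fin.cons v c, Fin.cons r l, ?_, ?_, ?_, ?_⟩
    · rw [orthonormal_iff_ite] at hc ⊢
      intro i j
      cases i using Fin.cases with
      | zero =>
        cases j using Fin.cases with
        | zero => simp [inner_self_eq_norm_sq_to_K, hv']
        | succ j =>
          simp only [Fin.cons_zero, Fin.cons_succ, (Fin.succ_ne_zero j).symm, if_false]
          rw [← inner_conj_symm, hperp, map_zero]
      | succ i =>
        cases j using Fin.cases with
        | zero => simp [hperp]
        | succ j => simp [hc]
    · intro k
      cases k using Fin.cases with
      | zero => exact v.2
      | succ k => exact (hcM k).2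
    · intro k
      cases k using Fin.cases with
      | zero => exact hr
      | succ k => exact hl k
    · intro i j
      cases i using Fin.cases with
      | zero =>
        cases j using Fin.cases with
        | zero => simp [hvZ' _ v.2, inner_self_eq_norm_sq_to_K, hv']
        | succ j =>
          simp [hvZ' _ (hcM j).2, hperp, (Fin.succ_ne_zero j).symm]
      | succ i =>
        cases j using Fin.cases with
        | zero => simp [hZ (c i), hvZ' _ (hcM i).2, hperp]
        | succ j => simp [hZc]

/-- **Takagi factorization**: a symmetric antilinear map `Z : V → V'` is diagonal, with
nonnegative entries, in some orthonormal basis of each finite-dimensional subspace `M`. -/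
theorem exists_takagi_basis (Z : V →ₗ⋆[ℂ] V →ₗ⋆[ℂ] ℂ) (hZ : ∀ x y, Z x y = Z y x)
    (M : Submodule ℂ V) [FiniteDimensional ℂ M] :
    ∃ (n : ℕ) (c : OrthonormalBasis (Fin n) ℂ M) (l : Fin n → ℝ), (∀ k, 0 ≤ l k) ∧
      ∀ k j, Z (c k) (c j) = if k = j then (l k : ℂ) else 0 := by
  obtain ⟨c, l, hc, hcM, hl, hZc⟩ := exists_takagi_family Z hZ _ M rfl
  have hc' := hc.codRestrict M hcM
  refine ⟨_, OrthonormalBasis.mk (𝕜 := ℂ) hc' ?_, l, hl, fun k j => ?_⟩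
  · rw [hc'.linearIndependent.span_eq_top_of_card_eq_finrank' (by simp)]
  · simpa using hZc k j

end Takagi


/-! ### The series of central binomial coefficients -/

section Series

theorem ennreal_tsum_mul_tsum (f g : ℕ → ℝ≥0∞) :
    (∑' n, f n) * ∑' n, g n = ∑' n, ∑ p ∈ Finset.HasAntidiagonal.antidiagonal n, f p.1 * g p.2 := by
  calc (∑' n, f n) * ∑' n, g n = ∑' p : ℕ × ℕ, f p.1 * g p.2 := by
        rw [ENNReal.tsum_prod (f := fun i j => f i * g j), ← ENNReal.tsum_mul_right]
        exact tsum_congr fun i => ENNReal.tsum_mul_left.symm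
    _ = ∑' x : (Σ n : ℕ, Finset.HasAntidiagonal.antidiagonal n), f x.2.1.1 * g x.2.1.2 :=
        (Finset.HasAntidiagonal.sigmaAntidiagonalEquivProd.tsum_eq
          (fun p : ℕ × ℕ => f p.1 * g p.2)).symm
    _ = _ := by
        rw [ENNReal.tsum_sigma (f := fun n
          (p : Finset.HasAntidiagonal.antidiagonal n) => f p.1.1 * g p.1.2)]
        refine tsum_congr fun n => ?_
        rw [tsum_fintype]
        exact Finset.sum_coe_sort (Finset.HasAntidiagonal.antidiagonal n) (fun p => f p.1 * g p.2)

/-- The index `p.1` averages to `n / 2` over the antidiagonal, by symmetry. -/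
theorem two_mul_sum_antidiagonal_fst_mul (a : ℕ → ℕ) (n : ℕ) :
    2 * ∑ p ∈ Finset.HasAntidiagonal.antidiagonal n, p.1 * (a p.1 * a p.2) =
      n * ∑ p ∈ Finset.HasAntidiagonal.antidiagonal n, a p.1 * a p.2 := by
  have h : ∑ p ∈ Finset.HasAntidiagonal.antidiagonal n, p.2 * (a p.2 * a p.1) =
      ∑ p ∈ Finset.HasAntidiagonal.antidiagonal n, p.1 * (a p.1 * a p.2) :=
    Finset.Nat.sum_antidiagonal_swap (f := fun p => p.1 * (a p.1 * a p.2))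
  rw [two_mul]
  nth_rewrite 2 [← h]
  rw [← Finset.sum_add_distrib, Finset.mul_sum]
  refine Finset.sum_congr rfl fun p hp => ?_
  rw [← Finset.HasAntidiagonal.mem_antidiagonal.1 hp]
  ring

/-- The square of the generating function of the central binomial coefficients is geometric. -/
theorem sum_antidiagonal_centralBinom (n : ℕ) :
    ∑ p ∈ Finset.HasAntidiagonal.antidiagonal n, p.1.centralBinom * p.2.centralBinom = 4 ^ n := by
  induction n with
  | zero => simp
  | succ n ih =>
    have h1 := two_mul_sum_antidiagonal_fst_mul Nat.centralBinom (n + 1)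
    rw [Finset.Nat.sum_antidiagonal_succ] at h1
    have h2 : ∀ p ∈ Finset.HasAntidiagonal.antidiagonal n,
        (p.1 + 1) * ((p.1 + 1).centralBinom * p.2.centralBinom) =
        4 * (p.1 * (p.1.centralBinom * p.2.centralBinom)) +
          2 * (p.1.centralBinom * p.2.centralBinom) := by
      intro p _
      rw [← mul_assoc, Nat.succ_mul_centralBinom_succ]
      ring
    simp only [zero_mul, zero_add] at h1
    rw [Finset.sum_congr rfl h2, Finset.sum_add_distrib, ← Finset.mul_sum, ← Finset.mul_sum] at h1
    have h3 := two_mul_sum_antidiagonal_fst_mul Nat.centralBinom n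
    rw [ih] at h1 h3
    have h4 : (n + 1) * 4 ^ (n + 1) = (n + 1) * ∑ p ∈ Finset.HasAntidiagonal.antidiagonal (n + 1),
        p.1.centralBinom * p.2.centralBinom := by
      rw [← h1, pow_succ]; linarith
    exact (Nat.eq_of_mul_eq_mul_left (Nat.succ_pos n) h4).symm

/-- `(1 - x)^(-1/2) = ∑ⱼ C(2j, j) (x / 4)^j`, squared, with value `∞` for `x ≥ 1`. -/
theorem sq_tsum_centralBinom {x : ℝ} (hx : 0 ≤ x) :
    (∑' j : ℕ, ENNReal.ofReal ((x / 4) ^ j * j.centralBinom)) ^ 2 = (1 - ENNReal.ofReal x)⁻¹ := by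
  rw [sq, ennreal_tsum_mul_tsum, ← ENNReal.tsum_geometric]
  refine tsum_congr fun n => ?_
  rw [← ENNReal.ofReal_pow hx]
  calc _ = ∑ p ∈ Finset.HasAntidiagonal.antidiagonal n,
        ENNReal.ofReal ((x / 4) ^ n * (p.1.centralBinom * p.2.centralBinom : ℕ)) := by
        refine Finset.sum_congr rfl fun p hp => ?_
        rw [← ENNReal.ofReal_mul (by positivity), ← Finset.HasAntidiagonal.mem_antidiagonal.1 hp,
          pow_add]
        push_cast
        ring_nf
    _ = _ := by
        rw [← ENNReal.ofReal_sum_of_nonneg (fun p _ => by positivity), ← Finset.mul_sum,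
          ← Nat.cast_sum, sum_antidiagonal_centralBinom]
        push_cast
        rw [← mul_pow, div_mul_cancel₀ _ (by norm_num)]

end Series

/-! ### The norm of a Gaussian on a finite-dimensional subspace -/

section Gaussian

variable {V : Type*} [NormedAddCommGroup V] [InnerProductSpace ℂ V]

theorem symInner_symPow_of_ne {M : Submodule ℂ V} {d e : ℕ} (h : d ≠ e) {ψ φ : Sym V}
    (hψ : ψ ∈ symPow M d) (hφ : φ ∈ symPow M e) : symInner ψ φ = 0 := by
  have hleft : ∀ (a : Sym V), symInner a 0 = 0 := fun a => by simp [symInner]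
  induction e generalizing d ψ φ with
  | zero =>
    obtain ⟨c, rfl⟩ := symPow_zero_mem hφ
    rw [symInner_smul_right]
    obtain ⟨d, rfl⟩ := Nat.exists_eq_succ_of_ne_zero h
    refine symPow_succ_induction (P := fun ψ => c * symInner ψ 1 = 0) ?_ ?_ hψ
    · intro v _ ψ _
      rw [← symInner_conj, symInner_ι_mul, ann_one]
      simp [symInner]
    · intro a b ha hb
      rw [symInner_add_left, mul_add, ha, hb, add_zero]
  | succ e ih =>
    refine symPow_succ_induction (P := fun φ => symInner ψ φ = 0) ?_ ?_ hφ
    · intro v _ φ hφ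
      rw [symInner_ι_mul]
      cases d with
      | zero =>
        obtain ⟨c, rfl⟩ := symPow_zero_mem hψ
        rw [map_smul, ann_one, smul_zero]
        simp [symInner]
      | succ d => exact ih (by omega) (ann_mem_symPow v hψ) hφ
    · intro a b ha hb
      rw [symInner_add_right, ha, hb, add_zero]

theorem symPow_induction {M : Submodule ℂ V} {d : ℕ} {P : Sym V → Prop}
    (hprod : ∀ x : Fin d → V, (∀ i, x i ∈ M) → P (∏ i, SymmetricAlgebra.ι ℂ V (x i)))
    (hadd : ∀ a b, P a → P b → P (a + b)) (hsmul : ∀ (c : ℂ) a, P a → P (c • a))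
    (hzero : P 0) {φ : Sym V} (h : φ ∈ symPow M d) : P φ := by
  rw [symPow, Submodule.pow_eq_span_pow_set] at h
  induction h using Submodule.span_induction with
  | mem z hz =>
    obtain ⟨f, rfl⟩ := Set.mem_pow.1 hz
    choose x hx hxf using fun i => (f i).2
    rw [List.prod_ofFn]
    simp only [← hxf]
    exact hprod x hx
  | zero => exact hzero
  | add a b _ _ ha hb => exact hadd a b ha hb
  | smul c a _ ha => exact hsmul c a ha

theorem linPart_prod_mem {M : Submodule ℂ V} {κ : Type*} (s : Finset κ) (x : κ → V)
    (hx : ∀ i ∈ s, x i ∈ M) : linPart (∏ i ∈ s, SymmetricAlgebra.ι ℂ V (x i)) ∈ M := by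
  by_cases hs : s.card = 1
  · obtain ⟨a, rfl⟩ := Finset.card_eq_one.1 hs
    rw [Finset.prod_singleton, linPart_ι]
    exact hx a (Finset.mem_singleton_self a)
  · rw [linPart_prod_eq_zero s x hs]
    exact M.zero_mem

/-- The quadratic `½ ∑ₖ lₖ cₖ²` in `S²V`. -/
noncomputable def diagQuadratic {κ : Type*} (s : Finset κ) (c : κ → V) (l : κ → ℝ) : Sym V :=
  ∑ k ∈ s, ((l k / 2 : ℝ) : ℂ) • (SymmetricAlgebra.ι ℂ V (c k)) ^ 2

/-- The terms `qⁿ / n!` of the exponential of the quadratic `q = ½ ∑ₖ lₖ cₖ²`. -/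
noncomputable def diagTerm {κ : Type*} (s : Finset κ) (c : κ → V) (l : κ → ℝ) (n : ℕ) : Sym V :=
  (n.factorial : ℂ)⁻¹ • diagQuadratic s c l ^ n

theorem diagQuadratic_mem {κ : Type*} {M : Submodule ℂ V} (s : Finset κ) {c : κ → V}
    (hc : ∀ k, c k ∈ M) (l : κ → ℝ) : diagQuadratic s c l ∈ symPow M 2 :=
  Submodule.sum_mem _ fun k _ => Submodule.smul_mem _ _
    (Submodule.pow_mem_pow _ (Submodule.mem_map_of_mem (hc k)) 2)

theorem diagTerm_mem {κ : Type*} {M : Submodule ℂ V} (s : Finset κ) {c : κ → V}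
    (hc : ∀ k, c k ∈ M) (l : κ → ℝ) (n : ℕ) : diagTerm s c l n ∈ symPow M (2 * n) := by
  rw [symPow, pow_mul]
  exact Submodule.smul_mem _ _ (Submodule.pow_mem_pow _ (diagQuadratic_mem s hc l) n)

theorem component_eq {Φ : Antidual V} {M : Submodule ℂ V} [FiniteDimensional ℂ M] {d : ℕ}
    {φ : Sym V} (hφ : φ ∈ symPow M d) (h : ∀ ψ ∈ symPow M d, Φ ψ = symInner ψ φ) :
    component Φ M d = φ :=
  (existsUnique_component Φ M d).unique (component_spec Φ M d) ⟨hφ, h⟩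

section Components

variable {Z : V →ₗ⋆[ℂ] V →ₗ⋆[ℂ] ℂ} {M : Submodule ℂ V} {κ : Type*}
  [Fintype κ] [DecidableEq κ] {c : OrthonormalBasis κ ℂ M} {l : κ → ℝ}

theorem apply_eq_sum_takagi (hc : ∀ k j, Z (c k) (c j) = if k = j then (l k : ℂ) else 0)
    {x y : V} (hx : x ∈ M) (hy : y ∈ M) :
    Z x y = ∑ k, (l k : ℂ) * (inner ℂ x (c k : V) * inner ℂ y (c k : V)) := by
  have key : ∀ z ∈ M, z = ∑ k, inner ℂ (c k : V) z • (c k : V) := by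
    intro z hz
    have := congrArg (Subtype.val) (c.sum_repr' ⟨z, hz⟩)
    simpa using this.symm
  conv_lhs => rw [key x hx, key y hy]
  simp only [map_sum, LinearMap.map_smulₛₗ, LinearMap.sum_apply, LinearMap.smul_apply, hc,
    inner_conj_symm, smul_eq_mul, mul_ite, mul_zero]
  refine Finset.sum_congr rfl fun k _ => ?_
  simp
  ring

/-- On products of vectors of `M`, the functional `ζ` is represented by `½ ∑ₖ lₖ cₖ²`. -/
theorem quadratic_eq_incl (hc : ∀ k j, Z (c k) (c j) = if k = j then (l k : ℂ) else 0)
    {α : Type*} [DecidableEq α] (s : Finset α) (x : α → V) (hx : ∀ i ∈ s, x i ∈ M) :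
    quadratic Z (∏ i ∈ s, SymmetricAlgebra.ι ℂ V (x i)) =
      incl (diagQuadratic Finset.univ (fun k => (c k : V)) l)
        (∏ i ∈ s, SymmetricAlgebra.ι ℂ V (x i)) := by
  have h1 : ∀ v : V, incl (SymmetricAlgebra.ι ℂ V v) = vec v := fun v => by
    rw [incl, SymmetricAlgebra.lift_ι_apply]
  simp only [diagQuadratic, map_sum, map_smul, sq, map_mul, h1, LinearMap.sum_apply,
    LinearMap.smul_apply, Antidual.mul_prod, vec_apply]
  rw [quadratic, LinearMap.smul_apply, LinearMap.comp_apply, LinearMap.comp_apply, comul_prod]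
  simp only [map_sum, TensorProduct.map_tmul, TensorProduct.lift.tmul]
  simp only [smul_eq_mul, Finset.mul_sum]
  rw [Finset.sum_comm]
  refine Finset.sum_congr rfl fun t ht => ?_
  have hts := Finset.mem_powerset.1 ht
  rw [apply_eq_sum_takagi hc (linPart_prod_mem t x fun i hi => hx i (hts hi))
    (linPart_prod_mem (s \ t) x fun i hi => hx i (Finset.sdiff_subset hi)), Finset.mul_sum]
  refine Finset.sum_congr rfl fun k _ => ?_
  push_cast
  ring

theorem quadratic_pow_eq_symInner
    (hc : ∀ k j, Z (c k) (c j) = if k = j then (l k : ℂ) else 0) (n : ℕ) {d : ℕ} {ψ : Sym V}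
    (hψ : ψ ∈ symPow M d) :
    (quadratic Z ^ n) ψ = symInner ψ (diagQuadratic Finset.univ (fun k => (c k : V)) l ^ n) := by
  rw [symInner, map_pow]
  refine symPow_induction (P := fun ψ => (quadratic Z ^ n) ψ =
    (incl (diagQuadratic Finset.univ (fun k => (c k : V)) l) ^ n) ψ) ?_ ?_ ?_ ?_ hψ
  · intro x hx
    generalize (Finset.univ : Finset (Fin d)) = s
    induction n generalizing s with
    | zero => rfl
    | succ n ih =>
      rw [pow_succ, pow_succ, Antidual.mul_prod, Antidual.mul_prod]
      refine Finset.sum_congr rfl fun t _ => ?_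
      rw [ih t, quadratic_eq_incl hc _ x fun i _ => hx i]
  · intro a b ha hb
    rw [map_add, map_add, ha, hb]
  · intro z a ha
    rw [LinearMap.map_smulₛₗ, LinearMap.map_smulₛₗ, ha]
  · rw [map_zero, map_zero]

theorem component_gaussian_even [FiniteDimensional ℂ M]
    (hc : ∀ k j, Z (c k) (c j) = if k = j then (l k : ℂ) else 0) (n : ℕ) :
    component (gaussian Z) M (2 * n) = diagTerm Finset.univ (fun k => (c k : V)) l n := by
  refine component_eq (diagTerm_mem _ (fun k => (c k).2) l n) fun ψ hψ => ?_
  change ∑ᶠ m : ℕ, ((m.factorial : ℂ)⁻¹ • quadratic Z ^ m) ψ = _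
  rw [finsum_eq_single _ n, LinearMap.smul_apply, quadratic_pow_eq_symInner hc n hψ, diagTerm,
    symInner_smul_right, smul_eq_mul]
  intro m hm
  rw [LinearMap.smul_apply, quadratic_pow_eq_symInner hc m hψ,
    symInner_symPow_of_ne (e := 2 * m) (by omega) hψ, smul_zero]
  rw [symPow, pow_mul]
  exact Submodule.pow_mem_pow _ (diagQuadratic_mem _ (fun k => (c k).2) l) m

theorem component_gaussian_odd [FiniteDimensional ℂ M]
    (hc : ∀ k j, Z (c k) (c j) = if k = j then (l k : ℂ) else 0) {d : ℕ}
    (hd : ∀ n, d ≠ 2 * n) :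
    component (gaussian Z) M d = 0 := by
  refine component_eq (Submodule.zero_mem _) fun ψ hψ => ?_
  change ∑ᶠ m : ℕ, ((m.factorial : ℂ)⁻¹ • quadratic Z ^ m) ψ = _
  rw [show symInner ψ 0 = 0 by simp [symInner]]
  refine (finsum_congr fun m => ?_).trans finsum_zero
  rw [LinearMap.smul_apply, quadratic_pow_eq_symInner hc m hψ,
    symInner_symPow_of_ne (e := 2 * m) (hd m) hψ, smul_zero]
  rw [symPow, pow_mul]
  exact Submodule.pow_mem_pow _ (diagQuadratic_mem _ (fun k => (c k).2) l) m

end Components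

theorem ann_ι_pow_succ_mul {v : V} (hv : ‖v‖ = 1) {φ : Sym V} (hφ : ann v φ = 0) (j : ℕ) :
    ann v (SymmetricAlgebra.ι ℂ V v ^ (j + 1) * φ) =
      ((j + 1 : ℕ) : ℂ) • (SymmetricAlgebra.ι ℂ V v ^ j * φ) := by
  have hvv : inner ℂ v v = (1 : ℂ) := by simp [inner_self_eq_norm_sq_to_K, hv]
  induction j with
  | zero => rw [zero_add, pow_one, ann_ι_mul, hvv, hφ]; simp
  | succ j ih =>
    rw [pow_succ', mul_assoc, ann_ι_mul, ih, hvv, mul_smul_comm, ← mul_assoc, ← pow_succ',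
      ← add_smul]
    congr 1
    push_cast
    ring

/-- Powers of a unit vector `v` are orthogonal, with `‖v^j‖² = j!`, also after multiplication by
elements in which `v` does not occur. -/
theorem symInner_ι_pow_mul {v : V} (hv : ‖v‖ = 1) {φ φ' : Sym V} (hφ : ann v φ = 0)
    (hφ' : ann v φ' = 0) (j j' : ℕ) :
    symInner (SymmetricAlgebra.ι ℂ V v ^ j * φ) (SymmetricAlgebra.ι ℂ V v ^ j' * φ') =
      if j = j' then (j.factorial : ℂ) * symInner φ φ' else 0 := by
  have h0 : ∀ a : Sym V, symInner 0 a = 0 := fun a => by simp [symInner]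
  induction j' generalizing j with
  | zero =>
    cases j with
    | zero => simp
    | succ j =>
      rw [if_neg (Nat.succ_ne_zero j), ← symInner_conj, pow_succ' _ j, mul_assoc, symInner_ι_mul,
        pow_zero, one_mul, hφ', h0, map_zero]
  | succ j' ih =>
    rw [pow_succ' _ j', mul_assoc, symInner_ι_mul]
    cases j with
    | zero => rw [pow_zero, one_mul, hφ, h0, if_neg (Nat.succ_ne_zero j').symm]
    | succ j =>
      rw [ann_ι_pow_succ_mul hv hφ, symInner_smul_left, ih, Complex.conj_natCast,
        Nat.factorial_succ]
      by_cases h : j = j'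
      · simp [h, mul_assoc]
      · simp [h]

theorem ann_diagTerm {κ : Type*} (s : Finset κ) {c : κ → V} (l : κ → ℝ) {v : V}
    (hv : ∀ k ∈ s, inner ℂ v (c k) = 0) (n : ℕ) : ann v (diagTerm s c l n) = 0 := by
  have h1 : ∀ φ : Sym V, ann v φ = 0 → ann v (diagQuadratic s c l * φ) = 0 := by
    intro φ hφ
    rw [diagQuadratic, Finset.sum_mul, map_sum]
    refine Finset.sum_eq_zero fun k hk => ?_
    rw [smul_mul_assoc, map_smul, sq, mul_assoc, ann_ι_mul, ann_ι_mul, hv k hk, hφ]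
    simp
  have h2 : ∀ n, ann v (diagQuadratic s c l ^ n) = 0 := by
    intro n
    induction n with
    | zero => rw [pow_zero, ann_one]
    | succ n ih => rw [pow_succ', h1 _ ih]
  rw [diagTerm, map_smul, h2, smul_zero]

theorem diagTerm_insert {κ : Type*} [DecidableEq κ] {s : Finset κ} {k : κ} (hk : k ∉ s)
    (c : κ → V) (l : κ → ℝ) (n : ℕ) :
    diagTerm (insert k s) c l n = ∑ p ∈ Finset.HasAntidiagonal.antidiagonal n,
      (((p.2.factorial : ℝ)⁻¹ * (l k / 2) ^ p.2 : ℝ) : ℂ) •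
        (SymmetricAlgebra.ι ℂ V (c k) ^ (2 * p.2) * diagTerm s c l p.1) := by
  have h1 : diagQuadratic (insert k s) c l = diagQuadratic s c l +
      ((l k / 2 : ℝ) : ℂ) • (SymmetricAlgebra.ι ℂ V (c k)) ^ 2 := by
    rw [diagQuadratic, Finset.sum_insert hk, add_comm]; rfl
  rw [diagTerm, h1, (Commute.all _ _).add_pow', Finset.smul_sum]
  refine Finset.sum_congr rfl fun p hp => ?_
  have hpn := Finset.HasAntidiagonal.mem_antidiagonal.1 hp
  rw [diagTerm, smul_pow, ← pow_mul, mul_smul_comm, mul_smul_comm, smul_smul,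
    mul_comm (diagQuadratic s c l ^ p.1), ← Nat.cast_smul_eq_nsmul ℂ, smul_smul, smul_smul]
  congr 1
  rw [← hpn, Nat.choose_symm_add, Nat.add_choose,
    Nat.cast_div (Nat.factorial_mul_factorial_dvd_factorial_add _ _)
    (by exact_mod_cast mul_ne_zero (Nat.factorial_ne_zero _) (Nat.factorial_ne_zero _))]
  have e1 : ((p.1 + p.2).factorial : ℂ) ≠ 0 := by exact_mod_cast Nat.factorial_ne_zero _
  have e2 : (p.1.factorial : ℂ) ≠ 0 := by exact_mod_cast Nat.factorial_ne_zero _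
  have e3 : (p.2.factorial : ℂ) ≠ 0 := by exact_mod_cast Nat.factorial_ne_zero _
  push_cast
  field_simp

theorem normSq_diagTerm_insert {κ : Type*} [DecidableEq κ] {s : Finset κ} {k : κ} (hk : k ∉ s)
    {c : κ → V} (hc : Orthonormal ℂ c) (l : κ → ℝ) (n : ℕ) :
    (symInner (diagTerm (insert k s) c l n) (diagTerm (insert k s) c l n)).re =
      ∑ p ∈ Finset.HasAntidiagonal.antidiagonal n,
        (symInner (diagTerm s c l p.1) (diagTerm s c l p.1)).re *
        ((l k ^ 2 / 4) ^ p.2 * p.2.centralBinom) := by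
  have hann : ∀ m, ann (c k) (diagTerm s c l m) = 0 := ann_diagTerm s l fun j hj =>
    hc.2 (by rintro rfl; exact hk hj)
  have hsum : ∀ (t : Finset (ℕ × ℕ)) (f : ℕ × ℕ → Sym V) (a : Sym V),
      symInner (∑ p ∈ t, f p) a = ∑ p ∈ t, symInner (f p) a := fun t f a => by simp [symInner]
  rw [diagTerm_insert hk, hsum, Complex.re_sum]
  refine Finset.sum_congr rfl fun p hp => ?_
  rw [symInner_sum_right, Finset.sum_eq_single p]
  · rw [symInner_smul_left, symInner_smul_right, symInner_ι_pow_mul (hc.1 k) (hann _) (hann _),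
      if_pos rfl, Complex.conj_ofReal, ← mul_assoc, ← mul_assoc, ← Complex.ofReal_natCast,
      ← Complex.ofReal_mul, ← Complex.ofReal_mul, Complex.re_ofReal_mul, mul_comm]
    congr 1
    rw [Nat.centralBinom_eq_two_mul_choose, two_mul, Nat.add_choose,
      Nat.cast_div (Nat.factorial_mul_factorial_dvd_factorial_add _ _)
      (by exact_mod_cast mul_ne_zero (Nat.factorial_ne_zero _) (Nat.factorial_ne_zero _))]
    have e3 : (p.2.factorial : ℝ) ≠ 0 := by exact_mod_cast Nat.factorial_ne_zero _
    rw [show l k ^ 2 / 4 = (l k / 2) * (l k / 2) by ring, mul_pow]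
    push_cast
    field_simp
  · intro q hq hqp
    rw [symInner_smul_left, symInner_smul_right, symInner_ι_pow_mul (hc.1 k) (hann _) (hann _),
      if_neg, mul_zero, mul_zero]
    intro h
    have h1 := Finset.HasAntidiagonal.mem_antidiagonal.1 hp
    have h2 := Finset.HasAntidiagonal.mem_antidiagonal.1 hq
    exact hqp (Prod.ext (by omega) (by omega))
  · exact fun h => absurd hp h

/-- The series of the norms of the terms of `exp (½ ∑ₖ lₖ cₖ²)` factors over `k`: a Cauchy
product. -/
theorem tsum_normSq_diagTerm {κ : Type*} [DecidableEq κ] {M : Submodule ℂ V}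
    [FiniteDimensional ℂ M] (s : Finset κ) {c : κ → V}
    (hc : Orthonormal ℂ c) (hcM : ∀ k, c k ∈ M) (l : κ → ℝ) :
    ∑' n, ENNReal.ofReal (symInner (diagTerm s c l n) (diagTerm s c l n)).re =
      ∏ k ∈ s, ∑' j : ℕ, ENNReal.ofReal ((l k ^ 2 / 4) ^ j * j.centralBinom) := by
  induction s using Finset.induction_on with
  | empty =>
    rw [Finset.prod_empty, tsum_eq_single 0]
    · simp [diagTerm, symInner_one]
    · intro n hn
      simp [diagTerm, diagQuadratic, zero_pow hn, symInner]
  | insert k s hk ih =>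
    rw [Finset.prod_insert hk, mul_comm, ← ih, ennreal_tsum_mul_tsum]
    refine tsum_congr fun n => ?_
    have hpos := fun m => (symInner_posDef M (diagTerm_mem s hcM l m)).1
    rw [normSq_diagTerm_insert hk hc,
      ENNReal.ofReal_sum_of_nonneg fun p _ => mul_nonneg (hpos _) (by positivity)]
    exact Finset.sum_congr rfl fun p _ => ENNReal.ofReal_mul (hpos _)

/-- In a Takagi basis of `M`, the Gaussian factors into one-dimensional Gaussians:
`‖(e^Z)_M‖⁴ = ∏ₖ (1 - lₖ²)⁻¹`, with value `∞` if some `lₖ ≥ 1`. -/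
theorem normOn_gaussian_pow_four {Z : V →ₗ⋆[ℂ] V →ₗ⋆[ℂ] ℂ} {M : Submodule ℂ V}
    [FiniteDimensional ℂ M] {κ : Type*} [Fintype κ] [DecidableEq κ] {c : OrthonormalBasis κ ℂ M}
    {l : κ → ℝ} (hc : ∀ k j, Z (c k) (c j) = if k = j then (l k : ℂ) else 0) :
    normOn (gaussian Z) M ^ 4 = ∏ k, (1 - ENNReal.ofReal (l k ^ 2))⁻¹ := by
  have horth : Orthonormal ℂ fun k => (c k : V) :=
    c.orthonormal.comp_linearIsometry M.subtypeₗᵢ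
  have hinj : Function.Injective fun n : ℕ => 2 * n := fun a b h => by
    simpa using h
  have h1 : ∑' d : ℕ, ENNReal.ofReal
      (symInner (component (gaussian Z) M d) (component (gaussian Z) M d)).re =
      ∏ k, ∑' j : ℕ, ENNReal.ofReal ((l k ^ 2 / 4) ^ j * j.centralBinom) := by
    rw [← tsum_normSq_diagTerm Finset.univ horth (fun k => (c k).2) l, ← hinj.tsum_eq]
    · exact tsum_congr fun n => by rw [component_gaussian_even hc]
    · intro d hd
      by_contra hd'
      refine hd ?_
      change ENNReal.ofReal _ = 0
      rw [component_gaussian_odd hc fun n hn => hd' ⟨n, hn.symm⟩]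
      simp [symInner]
  rw [normOn, h1, ← ENNReal.rpow_natCast, ← ENNReal.rpow_mul]
  norm_num
  rw [← Finset.prod_pow]
  exact Finset.prod_congr rfl fun k _ => sq_tsum_centralBinom (sq_nonneg _)

end Gaussian

/-! ### Compressions of the square of an antilinear operator -/

section Compressions

open scoped ComplexOrder
open Matrix

variable {V : Type*} [NormedAddCommGroup V] [InnerProductSpace ℂ V]

/-- The matrix of `T²` in the family `e`, for a symmetric antilinear operator `T`: by symmetry
`⟨eᵢ | T² eⱼ⟩ = ⟨T eⱼ | T eᵢ⟩`. -/
noncomputable def sqMatrix (T : V →L⋆[ℂ] V) {κ : Type*} (e : κ → V) : Matrix κ κ ℂ :=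
  Matrix.of fun i j => inner ℂ (T (e j)) (T (e i))

variable (T : V →L⋆[ℂ] V) {κ α : Type*} [Fintype κ] [DecidableEq κ] [Fintype α] [DecidableEq α]

omit [Fintype κ] [DecidableEq κ] in
theorem sqMatrix_isHermitian (e : κ → V) : (sqMatrix T e).IsHermitian := by
  ext i j
  simp [sqMatrix]

omit [DecidableEq κ] in
theorem star_dotProduct_sqMatrix_mulVec (e : κ → V) (x : κ → ℂ) :
    star x ⬝ᵥ (sqMatrix T e *ᵥ x) = ((‖T (∑ i, x i • e i)‖ ^ 2 : ℝ) : ℂ) := by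
  have h : ((‖T (∑ i, x i • e i)‖ ^ 2 : ℝ) : ℂ) =
      inner ℂ (T (∑ i, x i • e i)) (T (∑ i, x i • e i)) := by
    rw [inner_self_eq_norm_sq_to_K]; push_cast; rfl
  rw [h]
  simp only [map_sum, ContinuousLinearMap.map_smulₛₗ, inner_sum, sum_inner, inner_smul_left,
    inner_smul_right, dotProduct, mulVec, sqMatrix, Matrix.of_apply, Pi.star_apply,
    Finset.mul_sum, RCLike.star_def, Complex.conj_conj]
  exact Finset.sum_congr rfl fun i _ => Finset.sum_congr rfl fun j _ => by ring

omit [DecidableEq κ] in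
theorem sqMatrix_posSemidef (e : κ → V) : (sqMatrix T e).PosSemidef :=
  .of_dotProduct_mulVec_nonneg (sqMatrix_isHermitian T e) fun x => by
    rw [star_dotProduct_sqMatrix_mulVec, Complex.zero_le_real]; positivity

omit [DecidableEq κ] in
theorem norm_sum_smul_sq {e : κ → V} (he : Orthonormal ℂ e) (x : κ → ℂ) :
    ‖∑ i, x i • e i‖ ^ 2 = ∑ i, ‖x i‖ ^ 2 := by
  have h := he.inner_sum x x Finset.univ
  rw [inner_self_eq_norm_sq_to_K] at h
  have h2 : ((‖∑ i, x i • e i‖ ^ 2 : ℝ) : ℂ) = ((∑ i, ‖x i‖ ^ 2 : ℝ) : ℂ) := by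
    push_cast
    refine Eq.trans h (Finset.sum_congr rfl fun i _ => ?_)
    rw [← Complex.conj_mul']
  exact_mod_cast h2

theorem star_dotProduct_one_sub_sqMatrix_mulVec {e : κ → V} (he : Orthonormal ℂ e) (x : κ → ℂ) :
    star x ⬝ᵥ ((1 - sqMatrix T e) *ᵥ x) =
      ((‖∑ i, x i • e i‖ ^ 2 - ‖T (∑ i, x i • e i)‖ ^ 2 : ℝ) : ℂ) := by
  rw [sub_mulVec, dotProduct_sub, star_dotProduct_sqMatrix_mulVec, norm_sum_smul_sq he, one_mulVec]
  push_cast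
  congr 1
  exact Finset.sum_congr rfl fun i _ => Complex.conj_mul' _

theorem one_sub_sqMatrix_posSemidef (hT : ‖T‖ ≤ 1) {e : κ → V} (he : Orthonormal ℂ e) :
    (1 - sqMatrix T e).PosSemidef :=
  .of_dotProduct_mulVec_nonneg (isHermitian_one.sub (sqMatrix_isHermitian T e)) fun x => by
    rw [star_dotProduct_one_sub_sqMatrix_mulVec T he, Complex.zero_le_real, sub_nonneg]
    gcongr
    exact T.le_of_opNorm_le hT _ |>.trans_eq (one_mul _)

variable {T}

/-- Compressing `T` to the span of the orthonormal family `c`, before squaring, decreases `T²`: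
so `det (1 - T²)`, compressed, is at most the determinant of one minus the compressed square. -/
theorem det_one_sub_sqMatrix_le (hT : ‖T‖ ≤ 1) {c : κ → V} (hc : Orthonormal ℂ c) {l : κ → ℝ}
    (hl : ∀ k j, inner ℂ (c j) (T (c k)) = if k = j then (l k : ℂ) else 0) :
    (1 - sqMatrix T c).det ≤ ((∏ k, (1 - l k ^ 2) : ℝ) : ℂ) := by
  have h1 : ((∏ k, (1 - l k ^ 2) : ℝ) : ℂ) =
      (1 - Matrix.diagonal fun k => ((l k ^ 2 : ℝ) : ℂ)).det := by
    rw [← Matrix.diagonal_one, Matrix.diagonal_sub, Matrix.det_diagonal]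
    push_cast
    rfl
  rw [h1]
  refine det_le_det_of_posSemidef_sub (one_sub_sqMatrix_posSemidef T hT hc) ?_
  rw [sub_sub_sub_cancel_left]
  refine .of_dotProduct_mulVec_nonneg ((sqMatrix_isHermitian T c).sub ?_) fun x => ?_
  · exact Matrix.isHermitian_diagonal_of_self_adjoint _ (by ext; simp [Pi.star_apply])
  · have h2 : star x ⬝ᵥ ((Matrix.diagonal fun k => ((l k ^ 2 : ℝ) : ℂ)) *ᵥ x) =
        ((∑ k, ‖inner ℂ (c k) (T (∑ i, x i • c i))‖ ^ 2 : ℝ) : ℂ) := by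
      rw [dotProduct, Complex.ofReal_sum]
      refine Finset.sum_congr rfl fun k _ => ?_
      simp only [map_sum, ContinuousLinearMap.map_smulₛₗ, inner_sum, inner_smul_right, hl,
        mul_ite, mul_zero, Finset.sum_ite_eq', Finset.mem_univ, if_true, mulVec_diagonal,
        Pi.star_apply, RCLike.star_def]
      rw [norm_mul, Complex.norm_conj, Complex.norm_real, mul_pow, Real.norm_eq_abs, sq_abs,
        Complex.ofReal_mul, Complex.ofReal_pow ‖x k‖, ← Complex.conj_mul']
      ring
    rw [sub_mulVec, dotProduct_sub, star_dotProduct_sqMatrix_mulVec, h2, ← Complex.ofReal_sub,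
      Complex.zero_le_real, sub_nonneg]
    exact hc.sum_inner_products_le _

section Takagi

variable {N : Submodule ℂ V} {c : OrthonormalBasis κ ℂ N} {l : κ → ℝ} {e : α → V}

omit [DecidableEq κ] [Fintype α] [DecidableEq α] in
theorem inner_eq_sum_of_mem (c : OrthonormalBasis κ ℂ N) {x y : V} (hx : x ∈ N) (hy : y ∈ N) :
    inner ℂ x y = ∑ k, inner ℂ x (c k : V) * inner ℂ (c k : V) y :=
  (c.sum_inner_mul_inner (⟨x, hx⟩ : N) (⟨y, hy⟩ : N)).symm

omit [Fintype α] [DecidableEq α] in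
/-- If `N` contains the family `e` and its image under `T`, then the matrix of `T²` in `e` is
computed from the Takagi basis of `N`. -/
theorem sqMatrix_eq_of_mem
    (hl : ∀ k j, inner ℂ (c j : V) (T (c k)) = if k = j then (l k : ℂ) else 0)
    (he : ∀ i, e i ∈ N) (hTe : ∀ i, T (e i) ∈ N) :
    sqMatrix T e = (Matrix.of fun (k : κ) (i : α) => inner ℂ (c k : V) (e i))ᴴ *
      (Matrix.diagonal fun k => ((l k ^ 2 : ℝ) : ℂ)) *
      (Matrix.of fun (k : κ) (i : α) => inner ℂ (c k : V) (e i)) := by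
  have key : ∀ k i, inner ℂ (c k : V) (T (e i)) = l k * inner ℂ (e i) (c k : V) := by
    intro k i
    have h : e i = ∑ j, inner ℂ (c j : V) (e i) • (c j : V) := by
      have := congrArg (Subtype.val) (c.sum_repr' ⟨e i, he i⟩)
      simpa using this.symm
    conv_lhs => rw [h]
    simp only [map_sum, ContinuousLinearMap.map_smulₛₗ, inner_sum, inner_smul_right, hl]
    simp [inner_conj_symm, mul_comm]
  ext i j
  rw [sqMatrix, Matrix.of_apply, inner_eq_sum_of_mem c (hTe j) (hTe i), Matrix.mul_apply]
  refine Finset.sum_congr rfl fun k _ => ?_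
  rw [← inner_conj_symm, key, key, Matrix.mul_diagonal]
  simp [inner_conj_symm]
  ring

/-- The determinant of one minus `T²`, compressed to the span of `e`, is at least `det (1 - (T_N)²)`
when `N` contains `e` and `T e`: the former compresses the positive contraction `1 - (T_N)²`. -/
theorem prod_le_det_one_sub_sqMatrix
    (hl : ∀ k j, inner ℂ (c j : V) (T (c k)) = if k = j then (l k : ℂ) else 0)
    (hl1 : ∀ k, l k ^ 2 ≤ 1) (horth : Orthonormal ℂ e)
    (he : ∀ i, e i ∈ N) (hTe : ∀ i, T (e i) ∈ N) :
    ((∏ k, (1 - l k ^ 2) : ℝ) : ℂ) ≤ (1 - sqMatrix T e).det := by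
  set X : Matrix κ α ℂ := Matrix.of fun (k : κ) (i : α) => inner ℂ (c k : V) (e i) with hX
  have hXX : Xᴴ * X = 1 := by
    ext i j
    rw [Matrix.mul_apply, Matrix.one_apply, ← orthonormal_iff_ite.1 horth i j,
      inner_eq_sum_of_mem c (he i) (he j)]
    exact Finset.sum_congr rfl fun k _ => by simp [hX]
  have hd : (1 : Matrix κ κ ℂ) - Matrix.diagonal (fun k => ((l k ^ 2 : ℝ) : ℂ)) =
      Matrix.diagonal fun k => ((1 - l k ^ 2 : ℝ) : ℂ) := by
    rw [← Matrix.diagonal_one, Matrix.diagonal_sub]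
    congr 1
    ext k
    push_cast
    rfl
  have h1 : 1 - sqMatrix T e =
      Xᴴ * (Matrix.diagonal fun k => ((1 - l k ^ 2 : ℝ) : ℂ)) * X := by
    rw [sqMatrix_eq_of_mem hl he hTe, ← hX, ← hd, Matrix.mul_sub, Matrix.sub_mul,
      Matrix.mul_one, hXX]
  have h2 := det_mul_det_gram_le (B := Matrix.diagonal fun k => ((1 - l k ^ 2 : ℝ) : ℂ))
    (.diagonal fun k => by
      rw [Pi.zero_apply, Complex.zero_le_real]; exact sub_nonneg.2 (hl1 k))
    (by
      rw [← hd, sub_sub_cancel]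
      exact .diagonal fun k => by
        rw [Pi.zero_apply, Complex.zero_le_real]; positivity) X
  rw [hXX, Matrix.det_one, mul_one, Matrix.det_diagonal] at h2
  rw [h1]
  push_cast at h2 ⊢
  exact h2

omit [DecidableEq α] in
/-- The Hilbert–Schmidt sum of `T` over `e` is at most that of the compression of `T` to `N`. -/
theorem sum_norm_sq_le_of_mem
    (hl : ∀ k j, inner ℂ (c j : V) (T (c k)) = if k = j then (l k : ℂ) else 0)
    (horth : Orthonormal ℂ e) (he : ∀ i, e i ∈ N) (hTe : ∀ i, T (e i) ∈ N) :
    ∑ i, ‖T (e i)‖ ^ 2 ≤ ∑ k, l k ^ 2 := by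
  have h1 : ∀ i, ‖T (e i)‖ ^ 2 = ∑ k, l k ^ 2 * ‖inner ℂ (e i) (c k : V)‖ ^ 2 := by
    intro i
    have h := congrFun (congrFun (sqMatrix_eq_of_mem hl he hTe) i) i
    rw [sqMatrix, Matrix.of_apply, inner_self_eq_norm_sq_to_K, Matrix.mul_apply] at h
    have h2 : ((‖T (e i)‖ ^ 2 : ℝ) : ℂ) =
        ((∑ k, l k ^ 2 * ‖inner ℂ (e i) (c k : V)‖ ^ 2 : ℝ) : ℂ) := by
      push_cast
      refine Eq.trans h (Finset.sum_congr rfl fun k _ => ?_)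
      rw [Matrix.mul_diagonal, ← Complex.conj_mul', inner_conj_symm]
      simp
      ring
    exact_mod_cast h2
  rw [Finset.sum_congr rfl fun i _ => h1 i, Finset.sum_comm]
  refine Finset.sum_le_sum fun k _ => ?_
  rw [← Finset.mul_sum]
  refine mul_le_of_le_one_right (sq_nonneg _) ?_
  refine (horth.sum_inner_products_le _).trans ?_
  have : ‖(c k : V)‖ = 1 := c.orthonormal.1 k
  rw [this, one_pow]

end Takagi

end Compressions

/-! ### The Fredholm series -/

section Determinants

open scoped ComplexOrder Classical
open Matrix Filter Topology

variable {V : Type*} [NormedAddCommGroup V] [InnerProductSpace ℂ V]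

theorem hasSum_norm_inner_sq {κ : Type*} (b : HilbertBasis κ ℂ V) (x : V) :
    HasSum (fun i => ‖inner ℂ (b i) x‖ ^ 2) (‖x‖ ^ 2) := by
  have h := b.hasSum_inner_mul_inner x x
  rw [inner_self_eq_norm_sq_to_K] at h
  have h2 : HasSum (fun i => ((‖inner ℂ (b i) x‖ ^ 2 : ℝ) : ℂ)) ((‖x‖ ^ 2 : ℝ) : ℂ) := by
    rw [Complex.ofReal_pow]
    refine h.congr_fun fun i => ?_
    rw [Complex.ofReal_pow, ← Complex.conj_mul', inner_conj_symm]
  exact Complex.hasSum_ofReal.1 h2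

variable {T : V →L⋆[ℂ] V}

/-- The Hilbert–Schmidt norm, computed in any Hilbert basis, bounds the sum over any orthonormal
family: by symmetry of `T` the double sums of `|⟨bᵢ | T cₖ⟩|² = |⟨cₖ | T bᵢ⟩|²` agree. -/
theorem sum_norm_sq_le_tsum (hsymm : ∀ x y, inner ℂ y (T x) = inner ℂ x (T y)) {ι : Type*}
    {b : HilbertBasis ι ℂ V} (hs : Summable fun i => ‖T (b i)‖ ^ 2) {κ : Type*} {c : κ → V}
    (hc : Orthonormal ℂ c) (s : Finset κ) :
    ∑ k ∈ s, ‖T (c k)‖ ^ 2 ≤ ∑' i, ‖T (b i)‖ ^ 2 := by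
  refine hasSum_le (fun _ => ?_) (hasSum_sum fun k _ => hasSum_norm_inner_sq b (T (c k)))
    hs.hasSum
  rw [Finset.sum_congr rfl fun k _ => by rw [hsymm (c k) (b _)]]
  exact hc.sum_inner_products_le _

theorem summable_norm_sq (hsymm : ∀ x y, inner ℂ y (T x) = inner ℂ x (T y)) {ι κ : Type*}
    {b : HilbertBasis ι ℂ V} (hs : Summable fun i => ‖T (b i)‖ ^ 2) {c : κ → V}
    (hc : Orthonormal ℂ c) : Summable fun i => ‖T (c i)‖ ^ 2 :=
  summable_of_sum_le (fun _ => sq_nonneg _) (sum_norm_sq_le_tsum hsymm hs hc)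

theorem sum_minors_eq_det {κ : Type*} (e : κ → V) (F : Finset κ) (r : ℂ) :
    ∑ S ∈ F.powerset, (r • sqMatrix T fun i : S => e i).det =
      (1 + r • sqMatrix T fun i : F => e i).det :=
  (det_one_add_finset (fun i j => r * inner ℂ (T (e j)) (T (e i))) F).symm

theorem norm_det_neg_sqMatrix {κ : Type*} [Fintype κ] [DecidableEq κ] (e : κ → V) :
    ‖((-1 : ℂ) • sqMatrix T e).det‖ = (((1 : ℂ) • sqMatrix T e).det).re := by
  rw [det_smul, norm_mul, norm_pow, norm_neg, norm_one, one_pow, one_mul, one_smul]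
  have h := (sqMatrix_posSemidef T e).det_nonneg
  exact (Complex.re_eq_norm.2 h).symm

/-- The Fredholm series of `1 - T²` converges absolutely: the principal minors of `T²` are
nonnegative, and those inside a finite set `F` add up to `det (1 + (T²)_F) ≤ exp ‖T‖₂²`. -/
theorem summable_minors {κ : Type*} {e : κ → V} (hs : Summable fun i => ‖T (e i)‖ ^ 2) :
    Summable fun S : Finset κ => ((-1 : ℂ) • sqMatrix T fun i : S => e i).det := by
  refine Summable.of_norm (summable_of_sum_le (c := Real.exp (∑' i, ‖T (e i)‖ ^ 2))
    (fun S => norm_nonneg _) fun u => ?_)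
  have hsub : u ⊆ (u.sup id).powerset := fun S hS =>
    Finset.mem_powerset.2 (Finset.le_sup (f := id) hS)
  refine (Finset.sum_le_sum_of_subset_of_nonneg hsub fun S _ _ => norm_nonneg _).trans ?_
  set F := u.sup id
  simp only [norm_det_neg_sqMatrix]
  rw [← Complex.re_sum, sum_minors_eq_det, one_smul]
  refine (det_one_add_re_le_exp (sqMatrix_posSemidef T _)).trans (Real.exp_le_exp.2 ?_)
  have h1 : (sqMatrix T fun i : F => e i).trace.re = ∑ i ∈ F, ‖T (e i)‖ ^ 2 := by
    rw [Matrix.trace, Complex.re_sum, ← Finset.sum_coe_sort F]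
    refine Finset.sum_congr rfl fun i _ => ?_
    rw [Matrix.diag_apply, sqMatrix, Matrix.of_apply]
    exact inner_self_eq_norm_sq (𝕜 := ℂ) (T (e i))
  rw [h1]
  exact hs.sum_le_tsum F fun i _ => sq_nonneg _

/-- The Fredholm series of `1 - T²` in a given orthonormal family, and its sum as the limit of the
determinants of finite blocks. -/
theorem exists_hasSum_minors (hT : ‖T‖ ≤ 1) {κ : Type*} {e : κ → V} (he : Orthonormal ℂ e)
    (hs : Summable fun i => ‖T (e i)‖ ^ 2) :
    ∃ D : ℝ, HasSum (fun S : Finset κ => ((-1 : ℂ) • sqMatrix T fun i : S => e i).det) (D : ℂ) ∧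
      Tendsto (fun F : Finset κ => (1 - sqMatrix T fun i : F => e i).det) atTop (𝓝 (D : ℂ)) := by
  obtain ⟨D, hD⟩ := summable_minors hs
  have hlim : Tendsto (fun F : Finset κ => (1 - sqMatrix T fun i : F => e i).det) atTop (𝓝 D) := by
    refine (hD.comp tendsto_finset_powerset_atTop_atTop).congr fun F => ?_
    rw [Function.comp_apply, sum_minors_eq_det, neg_one_smul, sub_eq_add_neg]
  have h0 : 0 ≤ D := ge_of_tendsto' hlim fun F =>
    (one_sub_sqMatrix_posSemidef T hT (he.comp _ Subtype.val_injective)).det_nonneg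
  have hre : ((D.re : ℝ) : ℂ) = D :=
    Complex.conj_eq_iff_re.1 (Complex.conj_eq_iff_im.2 (Complex.le_def.1 h0).2.symm)
  exact ⟨D.re, by rwa [hre], by rwa [hre]⟩

/-- The Fredholm determinant bounds from below the determinants of the compressions of `1 - T²`:
the family `c` is approximated by its projections to finite parts of the basis. -/
theorem le_det_one_sub_sqMatrix (hT : ‖T‖ ≤ 1) {ι : Type*} {b : HilbertBasis ι ℂ V} {D : ℂ}
    (hD : Tendsto (fun F : Finset ι => (1 - sqMatrix T fun i : F => b i).det) atTop (𝓝 D))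
    {κ : Type*} [Fintype κ] [DecidableEq κ] {c : κ → V}
    (hc : Orthonormal ℂ c) : D ≤ (1 - sqMatrix T c).det := by
  let p : Finset ι → V → V := fun F v => ∑ i ∈ F, inner ℂ (b i) v • b i
  let G : Finset ι → Matrix κ κ ℂ := fun F =>
    Matrix.of fun j k => ∑ i ∈ F, inner ℂ (c j) (b i) * inner ℂ (b i) (c k)
  have hp : ∀ v, Tendsto (fun F => p F v) atTop (𝓝 v) := fun v => by
    have := b.hasSum_repr v
    simp only [b.repr_apply_apply] at this
    exact this
  have hG : Tendsto G atTop (𝓝 1) := by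
    refine tendsto_pi_nhds.2 fun j => tendsto_pi_nhds.2 fun k => ?_
    rw [Matrix.one_apply, ← orthonormal_iff_ite.1 hc j k]
    exact b.hasSum_inner_mul_inner (c j) (c k)
  have hK : Tendsto (fun F => sqMatrix T fun k => p F (c k)) atTop (𝓝 (sqMatrix T c)) := by
    refine tendsto_pi_nhds.2 fun j => tendsto_pi_nhds.2 fun k => ?_
    exact ((T.continuous.tendsto _).comp (hp (c k))).inner
      ((T.continuous.tendsto _).comp (hp (c j)))
  have hdet : Continuous fun A : Matrix κ κ ℂ => A.det := continuous_id.matrix_det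
  have hleft : Tendsto (fun F : Finset ι =>
      (1 - sqMatrix T fun i : F => b i).det * (G F).det) atTop (𝓝 D) := by
    have := hD.mul ((hdet.tendsto _).comp hG)
    rwa [Matrix.det_one, mul_one] at this
  have hright : Tendsto (fun F => (G F - sqMatrix T fun k => p F (c k)).det) atTop
      (𝓝 (1 - sqMatrix T c).det) := (hdet.tendsto _).comp (hG.sub hK)
  refine le_of_tendsto_of_tendsto' hleft hright fun F => ?_
  let X : Matrix F κ ℂ := Matrix.of fun i k => inner ℂ (b i) (c k)
  have he : Orthonormal ℂ fun i : F => b i := b.orthonormal.comp _ Subtype.val_injective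
  have hXX : Xᴴ * X = G F := by
    ext j k
    rw [Matrix.mul_apply]
    change _ = ∑ i ∈ F, inner ℂ (c j) (b i) * inner ℂ (b i) (c k)
    rw [← Finset.sum_coe_sort F]
    exact Finset.sum_congr rfl fun i _ => by simp [X]
  have hXKX : Xᴴ * (sqMatrix T fun i : F => b i) * X = sqMatrix T fun k => p F (c k) := by
    ext j k
    simp only [sqMatrix, Matrix.of_apply, p, map_sum, ContinuousLinearMap.map_smulₛₗ, inner_sum,
      sum_inner, inner_smul_left, inner_smul_right, Matrix.mul_apply, Finset.sum_mul,
      Finset.mul_sum]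
    simp only [← Finset.sum_coe_sort F]
    rw [Finset.sum_comm]
    refine Finset.sum_congr rfl fun i _ => Finset.sum_congr rfl fun i' _ => ?_
    simp [X]
    ring
  have h := det_mul_det_gram_le (one_sub_sqMatrix_posSemidef T hT he)
    (by rw [sub_sub_cancel]; exact sqMatrix_posSemidef T _) X
  rwa [Matrix.mul_sub, Matrix.sub_mul, Matrix.mul_one, hXX, hXKX] at h

end Determinants


/-! ### The norm of a Gaussian and the Fredholm determinant -/

section Norm

open Filter Topology

variable {V : Type*} [NormedAddCommGroup V] [InnerProductSpace ℂ V]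
  {Z : V →ₗ⋆[ℂ] V →ₗ⋆[ℂ] ℂ}

theorem one_sub_ofReal_inv {t : ℝ} (h0 : 0 ≤ t) (h1 : t < 1) :
    (1 - ENNReal.ofReal t)⁻¹ = ENNReal.ofReal (1 - t)⁻¹ := by
  rw [ENNReal.ofReal_inv_of_pos (sub_pos.2 h1), ENNReal.ofReal_sub _ h0, ENNReal.ofReal_one]

theorem prod_one_sub_ofReal_inv {κ : Type*} [Fintype κ] {l : κ → ℝ} (hl : ∀ k, l k ^ 2 < 1) :
    ∏ k, (1 - ENNReal.ofReal (l k ^ 2))⁻¹ = ENNReal.ofReal (∏ k, (1 - l k ^ 2))⁻¹ := by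
  rw [← Finset.prod_inv_distrib,
    ENNReal.ofReal_prod_of_nonneg fun k _ => inv_nonneg.2 (sub_nonneg.2 (hl k).le)]
  exact Finset.prod_congr rfl fun k _ => one_sub_ofReal_inv (sq_nonneg _) (hl k)

theorem normOn_le_fockNorm (Φ : Antidual V) (M : Submodule ℂ V) [h : FiniteDimensional ℂ M] :
    normOn Φ M ≤ fockNorm Φ :=
  le_iSup₂ (f := fun (M : Submodule ℂ V) (_ : FiniteDimensional ℂ M) => normOn Φ M) M h

/-- A finite-dimensional subspace that contains a finite family and its image under `T`. -/
theorem exists_subspace_mem {α : Type*} [Finite α] (e : α → V) (T : V → V) :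
    ∃ N : Submodule ℂ V, FiniteDimensional ℂ N ∧ (∀ i, e i ∈ N) ∧ ∀ i, T (e i) ∈ N :=
  ⟨Submodule.span ℂ (Set.range e ∪ Set.range fun i => T (e i)),
    FiniteDimensional.span_of_finite ℂ ((Set.finite_range _).union (Set.finite_range _)),
    fun i => Submodule.subset_span (Or.inl ⟨i, rfl⟩),
    fun i => Submodule.subset_span (Or.inr ⟨i, rfl⟩)⟩

theorem exp_neg_div_le {t q : ℝ} (h0 : 0 ≤ t) (ht : t ≤ q) (hq : q < 1) :
    Real.exp (-(t / (1 - q))) ≤ 1 - t := by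
  have h1 : 0 < 1 - t := by linarith
  have h2 : t / (1 - t) ≤ t / (1 - q) := by gcongr
  have h3 := Real.add_one_le_exp (t / (1 - t))
  have h4 : t / (1 - t) + 1 = (1 - t)⁻¹ := by field_simp; ring
  calc Real.exp (-(t / (1 - q))) ≤ Real.exp (-(t / (1 - t))) :=
        Real.exp_le_exp.2 (neg_le_neg h2)
    _ = (Real.exp (t / (1 - t)))⁻¹ := Real.exp_neg _
    _ ≤ 1 - t := inv_le_of_inv_le₀ h1 (by rw [← h4]; exact h3)

variable {T : V →L⋆[ℂ] V}

section

variable {M : Submodule ℂ V} {n : ℕ} {c : OrthonormalBasis (Fin n) ℂ M} {l : Fin n → ℝ}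

theorem inner_takagi (hZT : ∀ x y, Z x y = inner ℂ y (T x))
    (hc : ∀ k j, Z (c k) (c j) = if k = j then (l k : ℂ) else 0) (k j : Fin n) :
    inner ℂ (c j : V) (T (c k)) = if k = j then (l k : ℂ) else 0 := by
  rw [← hZT, hc]

theorem abs_takagi_le (hZT : ∀ x y, Z x y = inner ℂ y (T x))
    (hc : ∀ k j, Z (c k) (c j) = if k = j then (l k : ℂ) else 0) (k : Fin n) :
    |l k| ≤ ‖T (c k)‖ := by
  have h := norm_inner_le_norm (𝕜 := ℂ) (c k : V) (T (c k))
  have h1 : ‖(c k : V)‖ = 1 := c.orthonormal.1 k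
  rwa [inner_takagi hZT hc, if_pos rfl, h1, one_mul, Complex.norm_real] at h

theorem sq_takagi_le (hZT : ∀ x y, Z x y = inner ℂ y (T x))
    (hc : ∀ k j, Z (c k) (c j) = if k = j then (l k : ℂ) else 0) (k : Fin n) :
    l k ^ 2 ≤ ‖T‖ ^ 2 := by
  rw [← sq_abs]
  have h1 : ‖(c k : V)‖ = 1 := c.orthonormal.1 k
  gcongr
  exact (abs_takagi_le hZT hc k).trans ((T.le_opNorm _).trans_eq (by rw [h1, mul_one]))

end

section

open scoped ComplexOrder Classical

/-- The determinants of the compressions of `1 - T²` to finite parts of a basis dominate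
determinants `∏ (1 - lₖ²)` attached to compressions of `T`. -/
theorem exists_takagi_prod_le (hZ : ∀ x y, Z x y = Z y x)
    (hZT : ∀ x y, Z x y = inner ℂ y (T x)) (hT : ‖T‖ < 1) {κ : Type*} {e : κ → V}
    (he : Orthonormal ℂ e) (F : Finset κ) :
    ∃ (M : Submodule ℂ V) (_ : FiniteDimensional ℂ M) (n : ℕ)
      (c : OrthonormalBasis (Fin n) ℂ M) (l : Fin n → ℝ),
      (∀ k j, Z (c k) (c j) = if k = j then (l k : ℂ) else 0) ∧
      ∏ k, (1 - l k ^ 2) ≤ (1 - sqMatrix T fun i : F => e i).det.re := by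
  obtain ⟨N, hN, heN, hTN⟩ := exists_subspace_mem (fun i : F => e i) T
  obtain ⟨n, c, l, -, hc⟩ := exists_takagi_basis Z hZ N
  have hlt : ‖T‖ ^ 2 < 1 := pow_lt_one₀ (norm_nonneg _) hT two_ne_zero
  exact ⟨N, hN, n, c, l, hc, (Complex.le_def.1 (prod_le_det_one_sub_sqMatrix
    (inner_takagi hZT hc) (fun k => (sq_takagi_le hZT hc k).trans hlt.le)
    (he.comp _ Subtype.val_injective) heN hTN)).1⟩

theorem le_takagi_prod (hZT : ∀ x y, Z x y = inner ℂ y (T x)) (hT : ‖T‖ < 1) {ι : Type*}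
    {b : HilbertBasis ι ℂ V} {D : ℝ}
    (hD : Tendsto (fun F : Finset ι => (1 - sqMatrix T fun i : F => b i).det) atTop (𝓝 (D : ℂ)))
    {M : Submodule ℂ V} {n : ℕ} {c : OrthonormalBasis (Fin n) ℂ M} {l : Fin n → ℝ}
    (hc : ∀ k j, Z (c k) (c j) = if k = j then (l k : ℂ) else 0) : D ≤ ∏ k, (1 - l k ^ 2) := by
  have horth : Orthonormal ℂ fun k => (c k : V) :=
    c.orthonormal.comp_linearIsometry M.subtypeₗᵢ
  exact Complex.real_le_real.1 ((le_det_one_sub_sqMatrix hT.le hD horth).trans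
    (det_one_sub_sqMatrix_le hT.le horth (inner_takagi hZT hc)))

theorem tendsto_det_re {κ : Type*} {e : κ → V} {D : ℝ}
    (hD : Tendsto (fun F : Finset κ => (1 - sqMatrix T fun i : F => e i).det) atTop (𝓝 (D : ℂ))) :
    Tendsto (fun F : Finset κ => (1 - sqMatrix T fun i : F => e i).det.re) atTop (𝓝 D) :=
  (Complex.continuous_re.tendsto _).comp hD

/-- The Fredholm determinant of `1 - T²` is the infimum, over finite-dimensional subspaces `M`, of
the determinants `∏ (1 - lₖ²)` attached to the compressions of `T` to `M`; in particular it does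
not depend on the basis. -/
theorem exists_fredholmDet (hZ : ∀ x y, Z x y = Z y x) (hZT : ∀ x y, Z x y = inner ℂ y (T x))
    (hHS : IsHilbertSchmidt T) (hT : ‖T‖ < 1) :
    ∃ D : ℝ, 0 < D ∧ IsFredholmDet (1 - T.comp T) (D : ℂ) ∧
      (∀ (M : Submodule ℂ V) (n : ℕ) (c : OrthonormalBasis (Fin n) ℂ M) (l : Fin n → ℝ),
        (∀ k j, Z (c k) (c j) = if k = j then (l k : ℂ) else 0) → D ≤ ∏ k, (1 - l k ^ 2)) ∧
      ∀ D' : ℝ, D < D' → ∃ (M : Submodule ℂ V) (_ : FiniteDimensional ℂ M) (n : ℕ)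
        (c : OrthonormalBasis (Fin n) ℂ M) (l : Fin n → ℝ),
        (∀ k j, Z (c k) (c j) = if k = j then (l k : ℂ) else 0) ∧ ∏ k, (1 - l k ^ 2) < D' := by
  have hsymm : ∀ x y, inner ℂ y (T x) = inner ℂ x (T y) := fun x y => by rw [← hZT, hZ, hZT]
  obtain ⟨w₀, b₀, hs₀⟩ := hHS
  have hlt : ‖T‖ ^ 2 < 1 := pow_lt_one₀ (norm_nonneg _) hT two_ne_zero
  obtain ⟨D, -, hlim₀⟩ := exists_hasSum_minors hT.le b₀.orthonormal hs₀
  refine ⟨D, ?_, ?_, fun _ _ _ _ => le_takagi_prod hZT hT hlim₀, ?_⟩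
  · -- a lower bound for all compressions, from `1 - t ≥ exp (-t / (1 - ‖T‖²))` for `t ≤ ‖T‖²`
    refine lt_of_lt_of_le (Real.exp_pos (-((∑' i, ‖T (b₀ i)‖ ^ 2) / (1 - ‖T‖ ^ 2))))
      (ge_of_tendsto' (tendsto_det_re hlim₀) fun F => ?_)
    obtain ⟨M, _, n, c, l, hc, hle⟩ := exists_takagi_prod_le hZ hZT hT b₀.orthonormal F
    refine le_trans ?_ hle
    have horth : Orthonormal ℂ fun k => (c k : V) :=
      c.orthonormal.comp_linearIsometry M.subtypeₗᵢ
    have h1 : ∑ k, l k ^ 2 ≤ ∑' i, ‖T (b₀ i)‖ ^ 2 := by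
      refine le_trans (Finset.sum_le_sum fun k _ => ?_)
        (sum_norm_sq_le_tsum hsymm hs₀ horth Finset.univ)
      rw [← sq_abs]
      gcongr
      exact abs_takagi_le hZT hc k
    have h2 : 0 < 1 - ‖T‖ ^ 2 := sub_pos.2 hlt
    calc Real.exp (-((∑' i, ‖T (b₀ i)‖ ^ 2) / (1 - ‖T‖ ^ 2)))
        ≤ Real.exp (-((∑ k, l k ^ 2) / (1 - ‖T‖ ^ 2))) := by gcongr
      _ = ∏ k, Real.exp (-(l k ^ 2 / (1 - ‖T‖ ^ 2))) := by
          rw [Finset.sum_div, ← Finset.sum_neg_distrib, Real.exp_sum]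
      _ ≤ ∏ k, (1 - l k ^ 2) := Finset.prod_le_prod (fun k _ => (Real.exp_pos _).le)
          fun k _ => exp_neg_div_le (sq_nonneg _) (sq_takagi_le hZT hc k) hlt
  · intro w b
    obtain ⟨D₁, hsum, hlim⟩ := exists_hasSum_minors hT.le b.orthonormal
      (summable_norm_sq hsymm hs₀ b.orthonormal)
    have h1 : D₁ = D := by
      refine le_antisymm (ge_of_tendsto' (tendsto_det_re hlim₀) fun F => ?_)
        (ge_of_tendsto' (tendsto_det_re hlim) fun F => ?_)
      · obtain ⟨M, _, n, c, l, hc, hle⟩ := exists_takagi_prod_le hZ hZT hT b₀.orthonormal F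
        exact (le_takagi_prod hZT hT hlim hc).trans hle
      · obtain ⟨M, _, n, c, l, hc, hle⟩ := exists_takagi_prod_le hZ hZT hT b.orthonormal F
        exact (le_takagi_prod hZT hT hlim₀ hc).trans hle
    rw [← h1]
    refine hsum.congr_fun fun S => ?_
    congr 1
    ext i j
    have h2 : (1 - T.comp T - 1 : V →L[ℂ] V) (b j) = -T (T (b j)) := by simp
    rw [Matrix.of_apply, h2, inner_neg_right, ← hsymm]
    simp [sqMatrix]
  · intro D' hD'
    obtain ⟨F, hF⟩ := ((tendsto_det_re hlim₀).eventually (gt_mem_nhds hD')).exists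
    obtain ⟨M, hM, n, c, l, hc, hle⟩ := exists_takagi_prod_le hZ hZT hT b₀.orthonormal F
    exact ⟨M, hM, n, c, l, hc, lt_of_le_of_lt hle hF⟩

end

theorem exists_fredholmDet_and_fockNorm (hZ : ∀ x y, Z x y = Z y x)
    (hZT : ∀ x y, Z x y = inner ℂ y (T x)) (hHS : IsHilbertSchmidt T) (hT : ‖T‖ < 1) :
    ∃ D : ℝ, 0 < D ∧ IsFredholmDet (1 - T.comp T) (D : ℂ) ∧
      fockNorm (gaussian Z) ^ 2 = ENNReal.ofReal (Real.sqrt D)⁻¹ := by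
  obtain ⟨D, hD, hdet, hle, hlt⟩ := exists_fredholmDet hZ hZT hHS hT
  refine ⟨D, hD, hdet, ?_⟩
  have hpow : ∀ {m : ℕ}, m ≠ 0 → StrictMono fun a : ℝ≥0∞ => a ^ m := ENNReal.pow_right_strictMono
  have hT2 : ‖T‖ ^ 2 < 1 := pow_lt_one₀ (norm_nonneg _) hT two_ne_zero
  have hnorm : ∀ (M : Submodule ℂ V) [FiniteDimensional ℂ M] (n : ℕ)
      (c : OrthonormalBasis (Fin n) ℂ M) (l : Fin n → ℝ),
      (∀ k j, Z (c k) (c j) = if k = j then (l k : ℂ) else 0) →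
      normOn (gaussian Z) M ^ 4 = ENNReal.ofReal (∏ k, (1 - l k ^ 2))⁻¹ := by
    intro M _ n c l hc
    rw [normOn_gaussian_pow_four hc,
      prod_one_sub_ofReal_inv fun k => (sq_takagi_le hZT hc k).trans_lt hT2]
  have hsq : (ENNReal.ofReal (Real.sqrt D)⁻¹) ^ 2 = ENNReal.ofReal D⁻¹ := by
    rw [← ENNReal.ofReal_pow (by positivity), inv_pow, Real.sq_sqrt hD.le]
  refine (hpow two_ne_zero).injective ?_
  rw [hsq, ← pow_mul]
  norm_num only
  refine le_antisymm ?_ ?_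
  · have hroot : (ENNReal.ofReal (Real.sqrt (Real.sqrt D))⁻¹) ^ 4 = ENNReal.ofReal D⁻¹ := by
      rw [← ENNReal.ofReal_pow (by positivity), inv_pow,
        show (4 : ℕ) = 2 * 2 from rfl, pow_mul, Real.sq_sqrt (Real.sqrt_nonneg _),
        Real.sq_sqrt hD.le]
    rw [← hroot]
    refine pow_le_pow_left' (iSup₂_le ?_) 4
    intro M _
    refine (hpow four_ne_zero).le_iff_le.1 ?_
    obtain ⟨n, c, l, -, hc⟩ := exists_takagi_basis Z hZ M
    rw [hroot, hnorm M n c l hc]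
    exact ENNReal.ofReal_le_ofReal (inv_anti₀ hD (hle M n c l hc))
  · have hlim : Tendsto (fun D' : ℝ => ENNReal.ofReal D'⁻¹) (𝓝[>] D) (𝓝 (ENNReal.ofReal D⁻¹)) :=
      (ENNReal.continuous_ofReal.tendsto _).comp
        ((tendsto_inv₀ hD.ne').mono_left nhdsWithin_le_nhds)
    refine le_of_tendsto hlim ?_
    filter_upwards [self_mem_nhdsWithin] with D' hD'
    obtain ⟨M, _, n, c, l, hc, hlt'⟩ := hlt D' hD'
    refine le_trans ?_ (pow_le_pow_left' (normOn_le_fockNorm (gaussian Z) M) 4)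
    rw [hnorm M n c l hc]
    exact ENNReal.ofReal_le_ofReal
      (inv_anti₀ (hD.trans_le (hle M n c l hc)) hlt'.le)

end Norm

/-! ### Gaussians of finite norm -/

section Converse

variable {V : Type*} [NormedAddCommGroup V] [InnerProductSpace ℂ V]
  {Z : V →ₗ⋆[ℂ] V →ₗ⋆[ℂ] ℂ}

/-- If `e^Z` has finite norm, then the eigenvalues `lₖ` of the compressions of `Z` are bounded
away from `1`, and their squares have bounded sums. -/
theorem exists_takagi_bounds (hfin : fockNorm (gaussian Z) < ∞) :
    ∃ r C : ℝ, 0 ≤ r ∧ r < 1 ∧ ∀ (M : Submodule ℂ V) [FiniteDimensional ℂ M] (n : ℕ)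
      (c : OrthonormalBasis (Fin n) ℂ M) (l : Fin n → ℝ),
      (∀ k j, Z (c k) (c j) = if k = j then (l k : ℂ) else 0) →
      (∀ k, |l k| ≤ r) ∧ ∑ k, l k ^ 2 ≤ C := by
  -- adding `1` ensures `1 ≤ R` at once; any upper bound of the fourth power of the norm will do
  set R : ℝ := (fockNorm (gaussian Z) ^ 4).toReal + 1 with hR
  have hR1 : 1 ≤ R := by rw [hR]; linarith [ENNReal.toReal_nonneg (a := fockNorm (gaussian Z) ^ 4)]
  have hR0 : 0 < R := by linarith
  refine ⟨Real.sqrt (1 - R⁻¹), Real.log R, Real.sqrt_nonneg _, ?_, ?_⟩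
  · rw [Real.sqrt_lt' one_pos]
    have := inv_pos.2 hR0
    linarith
  intro M _ n c l hc
  have hle : ∏ k, (1 - ENNReal.ofReal (l k ^ 2))⁻¹ ≤ ENNReal.ofReal R := by
    rw [← normOn_gaussian_pow_four hc]
    refine (pow_le_pow_left' (normOn_le_fockNorm (gaussian Z) M) 4).trans ?_
    rw [← ENNReal.ofReal_toReal (ENNReal.pow_ne_top hfin.ne)]
    exact ENNReal.ofReal_le_ofReal (by rw [hR]; linarith)
  have hone : ∀ k, 1 ≤ (1 - ENNReal.ofReal (l k ^ 2))⁻¹ := fun k =>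
    ENNReal.one_le_inv.2 tsub_le_self
  have hlt : ∀ k, l k ^ 2 < 1 := by
    intro k
    by_contra hk
    rw [not_lt] at hk
    have h0 : (1 - ENNReal.ofReal (l k ^ 2))⁻¹ = ∞ := by
      rw [ENNReal.inv_eq_top, tsub_eq_zero_iff_le, ← ENNReal.ofReal_one]
      exact ENNReal.ofReal_le_ofReal hk
    have h1 := (Finset.single_le_prod' (fun k _ => hone k) (Finset.mem_univ k)).trans hle
    rw [h0] at h1
    exact absurd h1 (not_le.2 ENNReal.ofReal_lt_top)
  set E : ℝ := ∏ k, (1 - l k ^ 2) with hE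
  have hE0 : 0 < E := Finset.prod_pos fun k _ => sub_pos.2 (hlt k)
  have hRE : R⁻¹ ≤ E := by
    rw [prod_one_sub_ofReal_inv hlt, ENNReal.ofReal_le_ofReal_iff hR0.le] at hle
    exact inv_le_of_inv_le₀ hE0 hle
  constructor
  · intro k
    refine Real.abs_le_sqrt ?_
    have h1 : E ≤ 1 - l k ^ 2 := by
      rw [hE, ← Finset.mul_prod_erase _ _ (Finset.mem_univ k)]
      exact mul_le_of_le_one_right (sub_pos.2 (hlt k)).le
        (Finset.prod_le_one (fun j _ => (sub_pos.2 (hlt j)).le)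
          fun j _ => sub_le_self _ (sq_nonneg _))
    linarith
  · have h1 : E ≤ Real.exp (-∑ k, l k ^ 2) := by
      rw [← Finset.sum_neg_distrib, Real.exp_sum]
      exact Finset.prod_le_prod (fun j _ => (sub_pos.2 (hlt j)).le)
        fun j _ => Real.one_sub_le_exp_neg _
    have h2 := Real.log_le_log (inv_pos.2 hR0) (hRE.trans h1)
    rw [Real.log_exp, Real.log_inv] at h2
    linarith

/-- A bound for the Takagi values on all subspaces bounds the form `Z`; the span of `x` and `y`
suffices. -/
theorem norm_apply_le_of_takagi (hZ : ∀ x y, Z x y = Z y x) {r : ℝ} (hr : 0 ≤ r)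
    (h : ∀ (M : Submodule ℂ V) [FiniteDimensional ℂ M] (n : ℕ)
      (c : OrthonormalBasis (Fin n) ℂ M) (l : Fin n → ℝ),
      (∀ k j, Z (c k) (c j) = if k = j then (l k : ℂ) else 0) → ∀ k, |l k| ≤ r) (x y : V) :
    ‖Z x y‖ ≤ r * ‖x‖ * ‖y‖ := by
  obtain ⟨M, _, hxM, hyM⟩ : ∃ M : Submodule ℂ V, FiniteDimensional ℂ M ∧ x ∈ M ∧ y ∈ M :=
    ⟨Submodule.span ℂ {x, y}, FiniteDimensional.span_of_finite ℂ (Set.toFinite _),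
      Submodule.subset_span (by simp), Submodule.subset_span (by simp)⟩
  obtain ⟨n, c, l, -, hc⟩ := exists_takagi_basis Z hZ M
  have horth : Orthonormal ℂ fun k => (c k : V) :=
    c.orthonormal.comp_linearIsometry M.subtypeₗᵢ
  have hnorm : ∀ z : V, ∑ k, ‖inner ℂ z (c k : V)‖ ^ 2 ≤ ‖z‖ ^ 2 := fun z => by
    simp only [norm_inner_symm z]
    exact horth.sum_inner_products_le _
  have hcs : ∑ k, ‖inner ℂ x (c k : V)‖ * ‖inner ℂ y (c k : V)‖ ≤ ‖x‖ * ‖y‖ := by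
    refine abs_le_of_sq_le_sq' ?_ (by positivity) |>.2
    refine (Finset.sum_mul_sq_le_sq_mul_sq _ _ _).trans ?_
    rw [mul_pow]
    exact mul_le_mul (hnorm x) (hnorm y) (by positivity) (by positivity)
  rw [apply_eq_sum_takagi hc hxM hyM]
  refine (norm_sum_le _ _).trans ?_
  rw [mul_assoc]
  refine le_trans ?_ (mul_le_mul_of_nonneg_left hcs hr)
  rw [Finset.mul_sum]
  refine Finset.sum_le_sum fun k _ => ?_
  rw [norm_mul, norm_mul, Complex.norm_real]
  exact mul_le_mul_of_nonneg_right (h M n c l hc k) (by positivity)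

/-- A bounded antilinear map to the antidual is given by a bounded antilinear operator. -/
theorem exists_operator_of_norm_le [CompleteSpace V] {r : ℝ} (hr : 0 ≤ r)
    (h : ∀ x y, ‖Z x y‖ ≤ r * ‖x‖ * ‖y‖) :
    ∃ T : V →L⋆[ℂ] V, (∀ x y, Z x y = inner ℂ y (T x)) ∧ ‖T‖ ≤ r := by
  have hrep : ∀ x, ∃ t : V, ∀ y, Z x y = inner ℂ y t := by
    intro x
    let f : V →ₗ[ℂ] ℂ := (starLinearEquiv ℂ (A := ℂ)).toLinearMap.comp (Z x)
    have hf : ∀ y, f y = conj (Z x y) := fun y => rfl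
    let g : StrongDual ℂ V := f.mkContinuous (r * ‖x‖) fun y => by
      rw [hf, Complex.norm_conj]; exact h x y
    refine ⟨(InnerProductSpace.toDual ℂ V).symm g, fun y => ?_⟩
    have hg : inner ℂ ((InnerProductSpace.toDual ℂ V).symm g) y = conj (Z x y) :=
      InnerProductSpace.toDual_symm_apply
    rw [← inner_conj_symm, hg, Complex.conj_conj]
  choose t ht using hrep
  let T₀ : V →ₗ⋆[ℂ] V :=
    { toFun := t
      map_add' := fun x x' => ext_inner_left ℂ fun y => by
        rw [← ht, inner_add_right, ← ht, ← ht, map_add, LinearMap.add_apply]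
      map_smul' := fun a x => ext_inner_left ℂ fun y => by
        rw [← ht, inner_smul_right, ← ht, LinearMap.map_smulₛₗ, LinearMap.smul_apply, smul_eq_mul] }
  have hT₀ : ∀ x, ‖T₀ x‖ ≤ r * ‖x‖ := by
    intro x
    by_cases h0 : ‖T₀ x‖ = 0
    · rw [h0]; positivity
    · have h1 := h x (T₀ x)
      rw [ht, show t x = T₀ x from rfl, inner_self_eq_norm_sq_to_K, norm_pow] at h1
      have h2 : ‖T₀ x‖ * ‖T₀ x‖ ≤ r * ‖x‖ * ‖T₀ x‖ := by
        rw [← sq]; simpa using h1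
      exact le_of_mul_le_mul_right h2 (lt_of_le_of_ne (norm_nonneg _) (Ne.symm h0))
  exact ⟨T₀.mkContinuous r hT₀, fun x y => ht x y, T₀.mkContinuous_norm_le hr hT₀⟩

theorem exists_hilbertSchmidt_of_fockNorm_lt_top [CompleteSpace V] (hZ : ∀ x y, Z x y = Z y x)
    (hfin : fockNorm (gaussian Z) < ∞) :
    ∃ T : V →L⋆[ℂ] V, (∀ x y, Z x y = inner ℂ y (T x)) ∧ IsHilbertSchmidt T ∧ ‖T‖ < 1 := by
  obtain ⟨r, C, hr0, hr1, hb⟩ := exists_takagi_bounds hfin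
  obtain ⟨T, hZT, hTr⟩ := exists_operator_of_norm_le hr0
    (norm_apply_le_of_takagi hZ hr0 fun M _ n c l hc => (hb M n c l hc).1)
  refine ⟨T, hZT, ?_, hTr.trans_lt hr1⟩
  obtain ⟨w, b, -⟩ := exists_hilbertBasis ℂ V
  refine ⟨w, b, summable_of_sum_le (c := C) (fun i => sq_nonneg _) fun F => ?_⟩
  obtain ⟨N, _, heN, hTN⟩ := exists_subspace_mem (fun i : F => b i) T
  obtain ⟨n, c, l, -, hc⟩ := exists_takagi_basis Z hZ N
  rw [← Finset.sum_coe_sort F]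
  exact (sum_norm_sq_le_of_mem (inner_takagi hZT hc)
    (b.orthonormal.comp _ Subtype.val_injective) heN hTN).trans (hb N n c l hc).2

end Converse

end Fock

theorem mainTheorem3 {V : Type*} [NormedAddCommGroup V] [InnerProductSpace ℂ V] [CompleteSpace V]
    (Z : V →ₗ⋆[ℂ] V →ₗ⋆[ℂ] ℂ) (hZ : ∀ x y : V, Z x y = Z y x) :
    (Fock.gaussian Z ∈ Fock.fockSpace V ↔
      ∃ T : V →L⋆[ℂ] V, (∀ x y : V, Z x y = inner ℂ y (T x)) ∧
        Fock.IsHilbertSchmidt T ∧ ‖T‖ < 1) ∧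
    (∀ T : V →L⋆[ℂ] V, (∀ x y : V, Z x y = inner ℂ y (T x)) →
      Fock.IsHilbertSchmidt T → ‖T‖ < 1 →
      ∃ D : ℝ, 0 < D ∧ Fock.IsFredholmDet (1 - T.comp T) (D : ℂ) ∧
        Fock.fockNorm (Fock.gaussian Z) ^ 2 = ENNReal.ofReal (Real.sqrt D)⁻¹) := by
  refine ⟨⟨Fock.exists_hilbertSchmidt_of_fockNorm_lt_top hZ, ?_⟩, fun T hZT hHS hT =>
    Fock.exists_fredholmDet_and_fockNorm hZ hZT hHS hT⟩
  rintro ⟨T, hZT, hHS, hT⟩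
  obtain ⟨D, -, -, hD⟩ := Fock.exists_fredholmDet_and_fockNorm hZ hZT hHS hT
  change Fock.fockNorm (Fock.gaussian Z) < ∞
  refine lt_top_iff_ne_top.2 fun htop => ?_
  rw [htop, ENNReal.top_pow two_ne_zero] at hD
  exact ENNReal.ofReal_ne_top hD.symm
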